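/- **Language.** Let $\mathcal A$ be a finite non-empty set of agents. Formulae are given by $\varphi ::= \bot \mid p \mid \varphi\wedge\varphi \mid \varphi\vee\varphi \mid \varphi\to\varphi \mid K_a\varphi \mid C\varphi$ ($p$ an atom, $a\in\mathcal A$), and $\neg\varphi := \varphi\to\bot$. A set of formulae is *closed* if (1) with $\varphi\ast\psi$, $\ast\in\{\wedge,\vee,\to\}$, it contains $\varphi$ and $\psi$; (2) with $K_a\varphi$ it contains $\varphi$; (3) with $C\varphi$ it contains $\varphi$ and all $K_aC\varphi$, $a\in\mathcal A$. It is *negation closed* if moreover with $K_a\varphi$ it contains $\neg K_a\varphi$. **Sequents.** An annotated formula is $\varphi^u$ ($\varphi$ unfocused) or $\varphi^f$ ($\varphi$ in focus). A *sequent* $\Gamma\Rightarrow\Delta$ is a pair of finite sets of annotated formulae such that all formulae of $\Gamma$ are unfocused, at most one formula of $\Delta$ is in focus, and any formula in focus has the form $C\psi$ or $K_aC\psi$. It is a *$\Sigma$-sequent* if all its formulae, without annotations, are in $\Sigma$. **Rules** (conclusion $\leftarrow$ premises; commas denote unions of sets, $x\in\{u,f\}$, $K_a\Gamma=\{(K_a\varphi)^x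 : \varphi^x\in\Gamma\}$; conclusion and premises must be sequents): - $\mathsf{id}$: $\Gamma,\varphi^u\Rightarrow\varphi^x,\Delta$, and $\bot$: $\Gamma,\bot^u\Rightarrow\Delta$, both without premises (axioms); - $\wedge\mathsf L$: $\Gamma,(\varphi\wedge\psi)^u\Rightarrow\Delta \leftarrow \Gamma,\varphi^u,\psi^u\Rightarrow\Delta$; $\wedge\mathsf R$: $\Gamma\Rightarrow(\varphi\wedge\psi)^u,\Delta \leftarrow \Gamma\Rightarrow\varphi^u,\Delta;\ \Gamma\Rightarrow\psi^u,\Delta$; - $\vee\mathsf L$: $\Gamma,(\varphi\vee\psi)^u\Rightarrow\Delta \leftarrow \Gamma,\varphi^u\Rightarrow\Delta;\ \Gamma,\psi^u\Rightarrow\Delta$; $\vee\mathsf R$: $\Gamma\Rightarrow(\varphi\vee\psi)^u,\Delta \leftarrow \Gamma\Rightarrow\varphi^u,\psi^u,\Delta$; - ${\to}\mathsf L$: $\Gamma,(\varphi\to\psi)^u\Rightarrow\Delta \leftarrow \Gamma\Rightarrow\varphi^u,\Delta;\ \Gamma,\psi^u\Rightarrow\Delta$; ${\to}\mathsf R$: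 $\Gamma\Rightarrow(\varphi\to\psi)^u,\Delta \leftarrow \Gamma,\varphi^u\Rightarrow\psi^u$; - $\mathsf u$: $\Gamma\Rightarrow\varphi^f,\Delta \leftarrow \Gamma\Rightarrow\varphi^u,\Delta$; $\mathsf f$: $\Gamma\Rightarrow\varphi^u,\Delta \leftarrow \Gamma\Rightarrow\varphi^f,\Delta$; - $\mathsf K_a$: $\Pi,K_a\Gamma\Rightarrow (K_a\varphi)^x,\Theta \leftarrow \Gamma\Rightarrow\varphi^x$; $\mathsf T_a$: $\Gamma,(K_a\varphi)^u\Rightarrow\Delta \leftarrow \Gamma,\varphi^u\Rightarrow\Delta$; - $\mathsf{S4}_a$: $\Pi,K_a\Gamma\Rightarrow (K_a\varphi)^x,\Theta \leftarrow K_a\Gamma\Rightarrow\varphi^x$; $\mathsf{S5}_a$: $\Pi,K_a\Gamma\Rightarrow (K_a\varphi)^x,K_a\Delta,\Theta \leftarrow K_a\Gamma\Rightarrow\varphi^x,K_a\Delta$; - $\mathsf K_a{\to}$: $\Gamma\Rightarrow(K_a\varphi\to\psi)^u,\Delta \leftarrow \Gamma,(K_a\varphi)^u\Rightarrow\psi^u,\Delta$;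 - $\mathsf{CL}$: $\Gamma,(C\varphi)^u\Rightarrow\Delta \leftarrow \Gamma,\varphi^u,\{(K_aC\varphi)^u\}_{a\in\mathcal A}\Rightarrow\Delta$; - $\mathsf{CR}$: $\Gamma\Rightarrow(C\varphi)^x,\Delta \leftarrow \Gamma\Rightarrow\varphi^u,\Delta;\ \{\Gamma\Rightarrow(K_aC\varphi)^x,\Delta\}_{a\in\mathcal A}$, with principal formula $(C\varphi)^x$; - $\mathsf{cut}$: $\Gamma\Rightarrow\Delta \leftarrow \Gamma,\varphi^u\Rightarrow\Delta;\ \Gamma\Rightarrow\varphi^u,\Delta$. **Calculi.** $\mathrm{cICK}$ has the rules $\mathsf{id},\bot,\wedge\mathsf L,\wedge\mathsf R,\vee\mathsf L,\vee\mathsf R,{\to}\mathsf L,{\to}\mathsf R,\mathsf u,\mathsf f,\mathsf{CL},\mathsf{CR}$ and all $\mathsf K_a$. $\mathrm{cICKT}$ adds all $\mathsf T_a$ to $\mathrm{cICK}$. $\mathrm{cICKS4}$ is $\mathrm{cICKT}$ with $\mathsf K_a$ replaced by $\mathsf{S4}_a$. $\mathrm{cICKS5}$ is $\mathrm{cICKS4}$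 with $\mathsf{S4}_a$ replaced by $\mathsf{S5}_a$, together with all $\mathsf K_a{\to}$ and $\mathsf{cut}$. **Proofs.** A *cyclic $\mathrm P$-proof* of $\sigma$ is a finite tree labelled by sequents according to the rules of $\mathrm P$, with root labelled $\sigma$, such that each leaf $l$ either is an axiom or has a proper ancestor $c(l)$ with the same label such that on the path from $c(l)$ to $l$ every sequent has a formula in focus and the path passes through an instance of $\mathsf{CR}$ whose principal formula is in focus. $\sigma$ is *$\mathrm P$-provable* if it has a cyclic $\mathrm P$-proof. A *$\Sigma$-proof* is a cyclic $\mathrm P$-proof in which only $\Sigma$-sequents occur. It is *uniform* if there is a function $g$ from $\Sigma$-sequents to rule instances of $\mathrm P$ involving only $\Sigma$-sequents, such that every sequent $\tau$ that is the conclusion of a rule instance (possibly an axiom) in the proof is so by the instance $g(\tau)$. **Game.** For a $\Sigma$-sequent $\sigma$, the game $\mathscr G(\mathrm P,\sigma)$ has as positions the $\Sigma$-sequents and the $\Sigma$-rule positions, i.e. the triples $\langle\tau,\mathsf r,\langle\tau_1,\dots,\tau_n\rangle\rangle$ of $\Sigma$-sequents that are instances of rules $\mathsf r$ of $\mathrm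 P$. It starts in $\sigma$. A sequent $\tau$ belongs to Prover, who moves to a $\Sigma$-rule position with conclusion $\tau$; a rule position belongs to Refuter, who moves to one of its premises. Sequents without a formula in focus have priority 3, instances of $\mathsf{CR}$ with principal formula in focus have priority 2, and all other positions have priority 1. A play is finite, ending in a position whose owner cannot move, or infinite. Prover wins a finite play if it ends in a position of Refuter, and an infinite play if the highest priority encountered infinitely often is even; Refuter wins the other plays. A *memoryless strategy* for Prover is a partial function on positions that maps each position owned by Prover to an admissible move if there is one; it is *winning* if Prover wins every play from $\sigma$ in which it is used. **Theorem.** Let $\mathrm P\in\{\mathrm{cICK},\mathrm{cICKT},\mathrm{cICKS4},\mathrm{cICKS5}\}$, let $\Sigma$ be a finite set of formulae which is closed (negation closed if $\mathrm P=\mathrm{cICKS5}$), and let $\sigma$ be a $\Sigma$-sequent. The following are equivalent: 1. $\sigma$ is $\mathrm P$-provable. 2. $\sigma$ has a $\Sigma$-proof in $\mathrm P$. 3. Prover has a memoryless winning strategy in $\mathscr G(\mathrm P,\sigma)$. 4. $\sigma$ has a uniform $\Sigma$-proof in $\mathrm P$. -/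

import Mathlib

namespace ICK

/-- Formulae of intuitionistic common knowledge logic over the agents `A` and the atoms `At`. -/
inductive Formula (A At : Type*) : Type _
  | bot : Formula A At
  | atom (p : At) : Formula A At
  | and (φ ψ : Formula A At) : Formula A At
  | or (φ ψ : Formula A At) : Formula A At
  | imp (φ ψ : Formula A At) : Formula A At
  | know (a : A) (φ : Formula A At) : Formula A At
  | common (φ : Formula A At) : Formula A At

/-- `¬ φ` abbreviates `φ → ⊥`. -/
abbrev Formula.neg {A At : Type*} (φ : Formula A At) : Formula A At := .imp φ .bot

/-- Closed sets of formulae. -/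
structure IsClosedSet {A At : Type*} (S : Set (Formula A At)) : Prop where
  and_mem : ∀ φ ψ, Formula.and φ ψ ∈ S → φ ∈ S ∧ ψ ∈ S
  or_mem : ∀ φ ψ, Formula.or φ ψ ∈ S → φ ∈ S ∧ ψ ∈ S
  imp_mem : ∀ φ ψ, Formula.imp φ ψ ∈ S → φ ∈ S ∧ ψ ∈ S
  know_mem : ∀ a φ, Formula.know a φ ∈ S → φ ∈ S
  common_mem : ∀ φ, Formula.common φ ∈ S →
    φ ∈ S ∧ ∀ a, Formula.know a (.common φ) ∈ S

/-- Negation closed sets of formulae. -/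
structure IsNegClosedSet {A At : Type*} (S : Set (Formula A At)) : Prop extends
    IsClosedSet S where
  neg_know_mem : ∀ a φ, Formula.know a φ ∈ S → (Formula.know a φ).neg ∈ S

/-- Annotations: unfocused and in focus. -/
inductive Ann : Type
  | unfoc : Ann
  | foc : Ann

/-- Annotated formulae. -/
abbrev AFormula (A At : Type*) : Type _ := Formula A At × Ann

/-- Pairs `Γ ⇒ Δ` of finite sets of annotated formulae. -/
@[ext] structure PreSequent (A At : Type*) : Type _ where
  left : Finset (AFormula A At)
  right : Finset (AFormula A At)

/-- The formulae that may be in focus: `C ψ` and `K_a C ψ`. -/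
def Formula.Focusable {A At : Type*} (φ : Formula A At) : Prop :=
  (∃ ψ, φ = .common ψ) ∨ ∃ a ψ, φ = .know a (.common ψ)

/-- Sequents. -/
@[ext] structure Sequent (A At : Type*) : Type _ extends PreSequent A At where
  left_unfocused : ∀ φ : Formula A At, (φ, Ann.foc) ∉ left
  focus_unique : ∀ φ ψ : Formula A At,
    (φ, Ann.foc) ∈ right → (ψ, Ann.foc) ∈ right → φ = ψ
  focusable : ∀ φ : Formula A At, (φ, Ann.foc) ∈ right → φ.Focusable

/-- Some formula of the sequent is in focus. -/
def Sequent.HasFocus {A At : Type*} (σ : Sequent A At) : Prop :=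
  ∃ φ : Formula A At, (φ, Ann.foc) ∈ σ.right

/-- `σ` is an `S`-sequent: all its formulae, stripped of annotations, belong to `S`. -/
def Sequent.IsOver {A At : Type*} (S : Finset (Formula A At)) (σ : Sequent A At) : Prop :=
  ∀ φ : Formula A At, ∀ b : Ann, (φ, b) ∈ σ.left ∨ (φ, b) ∈ σ.right → φ ∈ S

/-- Names of the inference rules. -/
inductive RuleName (A : Type*) : Type _
  | ax : RuleName A
  | bot : RuleName A
  | andL : RuleName A
  | andR : RuleName A
  | orL : RuleName A
  | orR : RuleName A
  | impL : RuleName A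
  | impR : RuleName A
  | unfocus : RuleName A
  | focus : RuleName A
  | ruleK (a : A) : RuleName A
  | ruleT (a : A) : RuleName A
  | ruleS4 (a : A) : RuleName A
  | ruleS5 (a : A) : RuleName A
  | knowImp (a : A) : RuleName A
  | commonL : RuleName A
  | commonR : RuleName A
  | cut : RuleName A

open scoped Classical in
/-- `K_a Γ`; annotations are kept. -/
noncomputable def knowSet {A At : Type*} (a : A) (Γ : Finset (AFormula A At)) :
    Finset (AFormula A At) :=
  Γ.image fun x => (Formula.know a x.1, x.2)

open scoped Classical in
/-- The premises of the right unfolding rule for the principal formula `C φ` with annotation `b`: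
`Γ ⇒ φ^u, Δ` followed by `Γ ⇒ (K_a C φ)^b, Δ` for every agent `a`. -/
noncomputable def commonRPremises {A At : Type*} [Fintype A] (Γ Δ : Finset (AFormula A At))
    (φ : Formula A At) (b : Ann) : List (PreSequent A At) :=
  ⟨Γ, insert (φ, .unfoc) Δ⟩ ::
    (Finset.univ : Finset A).toList.map fun a =>
      ⟨Γ, insert (Formula.know a (.common φ), b) Δ⟩

open scoped Classical in
/-- `Rule r σ [σ₁, …, σₙ]`: the rule `r` allows to infer `σ` from `σ₁, …, σₙ`. Commas denote unions
of sets, so a context may contain the principal formula. -/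
inductive Rule {A At : Type*} [Fintype A] :
    RuleName A → PreSequent A At → List (PreSequent A At) → Prop
  | ax (Γ Δ : Finset (AFormula A At)) (φ : Formula A At) (b : Ann) :
      Rule .ax ⟨insert (φ, .unfoc) Γ, insert (φ, b) Δ⟩ []
  | bot (Γ Δ : Finset (AFormula A At)) :
      Rule .bot ⟨insert (.bot, .unfoc) Γ, Δ⟩ []
  | andL (Γ Δ : Finset (AFormula A At)) (φ ψ : Formula A At) :
      Rule .andL ⟨insert (.and φ ψ, .unfoc) Γ, Δ⟩
        [⟨insert (φ, .unfoc) (insert (ψ, .unfoc) Γ), Δ⟩]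
  | andR (Γ Δ : Finset (AFormula A At)) (φ ψ : Formula A At) :
      Rule .andR ⟨Γ, insert (.and φ ψ, .unfoc) Δ⟩
        [⟨Γ, insert (φ, .unfoc) Δ⟩, ⟨Γ, insert (ψ, .unfoc) Δ⟩]
  | orL (Γ Δ : Finset (AFormula A At)) (φ ψ : Formula A At) :
      Rule .orL ⟨insert (.or φ ψ, .unfoc) Γ, Δ⟩
        [⟨insert (φ, .unfoc) Γ, Δ⟩, ⟨insert (ψ, .unfoc) Γ, Δ⟩]
  | orR (Γ Δ : Finset (AFormula A At)) (φ ψ : Formula A At) :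
      Rule .orR ⟨Γ, insert (.or φ ψ, .unfoc) Δ⟩
        [⟨Γ, insert (φ, .unfoc) (insert (ψ, .unfoc) Δ)⟩]
  | impL (Γ Δ : Finset (AFormula A At)) (φ ψ : Formula A At) :
      Rule .impL ⟨insert (.imp φ ψ, .unfoc) Γ, Δ⟩
        [⟨Γ, insert (φ, .unfoc) Δ⟩, ⟨insert (ψ, .unfoc) Γ, Δ⟩]
  | impR (Γ Δ : Finset (AFormula A At)) (φ ψ : Formula A At) :
      Rule .impR ⟨Γ, insert (.imp φ ψ, .unfoc) Δ⟩
        [⟨insert (φ, .unfoc) Γ, {(ψ, .unfoc)}⟩]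
  | unfocus (Γ Δ : Finset (AFormula A At)) (φ : Formula A At) :
      Rule .unfocus ⟨Γ, insert (φ, .foc) Δ⟩ [⟨Γ, insert (φ, .unfoc) Δ⟩]
  | focus (Γ Δ : Finset (AFormula A At)) (φ : Formula A At) :
      Rule .focus ⟨Γ, insert (φ, .unfoc) Δ⟩ [⟨Γ, insert (φ, .foc) Δ⟩]
  | ruleK (a : A) (Γ Ξ Θ : Finset (AFormula A At)) (φ : Formula A At) (b : Ann) :
      Rule (.ruleK a) ⟨Ξ ∪ knowSet a Γ, insert (.know a φ, b) Θ⟩ [⟨Γ, {(φ, b)}⟩]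
  | ruleT (a : A) (Γ Δ : Finset (AFormula A At)) (φ : Formula A At) :
      Rule (.ruleT a) ⟨insert (.know a φ, .unfoc) Γ, Δ⟩ [⟨insert (φ, .unfoc) Γ, Δ⟩]
  | ruleS4 (a : A) (Γ Ξ Θ : Finset (AFormula A At)) (φ : Formula A At) (b : Ann) :
      Rule (.ruleS4 a) ⟨Ξ ∪ knowSet a Γ, insert (.know a φ, b) Θ⟩ [⟨knowSet a Γ, {(φ, b)}⟩]
  | ruleS5 (a : A) (Γ Δ Ξ Θ : Finset (AFormula A At)) (φ : Formula A At) (b : Ann) :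
      Rule (.ruleS5 a) ⟨Ξ ∪ knowSet a Γ, insert (.know a φ, b) (knowSet a Δ ∪ Θ)⟩
        [⟨knowSet a Γ, insert (φ, b) (knowSet a Δ)⟩]
  | knowImp (a : A) (Γ Δ : Finset (AFormula A At)) (φ ψ : Formula A At) :
      Rule (.knowImp a) ⟨Γ, insert (.imp (.know a φ) ψ, .unfoc) Δ⟩
        [⟨insert (.know a φ, .unfoc) Γ, insert (ψ, .unfoc) Δ⟩]
  | commonL (Γ Δ : Finset (AFormula A At)) (φ : Formula A At) :
      Rule .commonL ⟨insert (.common φ, .unfoc) Γ, Δ⟩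
        [⟨insert (φ, .unfoc)
            ((Finset.univ : Finset A).image (fun a => (Formula.know a (.common φ), Ann.unfoc)) ∪ Γ),
          Δ⟩]
  | commonR (Γ Δ : Finset (AFormula A At)) (φ : Formula A At) (b : Ann) :
      Rule .commonR ⟨Γ, insert (.common φ, b) Δ⟩ (commonRPremises Γ Δ φ b)
  | cut (Γ Δ : Finset (AFormula A At)) (φ : Formula A At) :
      Rule .cut ⟨Γ, Δ⟩ [⟨insert (φ, .unfoc) Γ, Δ⟩, ⟨Γ, insert (φ, .unfoc) Δ⟩]

/-- The four cyclic calculi. -/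
inductive Calculus : Type
  | cICK : Calculus
  | cICKT : Calculus
  | cICKS4 : Calculus
  | cICKS5 : Calculus

/-- The rules of each calculus. -/
def Calculus.HasRule {A : Type*} : Calculus → RuleName A → Prop
  | .cICK, .ruleK _ => True
  | .cICK, .ruleT _ => False
  | .cICK, .ruleS4 _ => False
  | .cICK, .ruleS5 _ => False
  | .cICK, .knowImp _ => False
  | .cICK, .cut => False
  | .cICKT, .ruleK _ => True
  | .cICKT, .ruleT _ => True
  | .cICKT, .ruleS4 _ => False
  | .cICKT, .ruleS5 _ => False
  | .cICKT, .knowImp _ => False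
  | .cICKT, .cut => False
  | .cICKS4, .ruleK _ => False
  | .cICKS4, .ruleT _ => True
  | .cICKS4, .ruleS4 _ => True
  | .cICKS4, .ruleS5 _ => False
  | .cICKS4, .knowImp _ => False
  | .cICKS4, .cut => False
  | .cICKS5, .ruleK _ => False
  | .cICKS5, .ruleT _ => True
  | .cICKS5, .ruleS4 _ => False
  | .cICKS5, .ruleS5 _ => True
  | .cICKS5, .knowImp _ => True
  | .cICKS5, .cut => True
  | _, _ => True

/-- The closure condition on sets of formulae that goes with each calculus: negation closed for
`cICKS5`, closed for the others. -/
def Calculus.IsClosed {A At : Type*} (P : Calculus) (S : Set (Formula A At)) : Prop :=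
  match P with
  | .cICKS5 => IsNegClosedSet S
  | _ => IsClosedSet S

/-- Triples `⟨σ, r, ⟨σ₁, …, σₙ⟩⟩`. -/
structure RuleTriple (A At : Type*) : Type _ where
  conclusion : Sequent A At
  rule : RuleName A
  premises : List (Sequent A At)

/-- The triple is a rule position (a rule instance) of the calculus `P`. -/
def RuleTriple.IsInstance {A At : Type*} [Fintype A] (P : Calculus) (i : RuleTriple A At) : Prop :=
  P.HasRule i.rule ∧
    Rule i.rule i.conclusion.toPreSequent (i.premises.map Sequent.toPreSequent)

/-- Only `S`-sequents occur in the triple. -/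
def RuleTriple.IsOver {A At : Type*} (S : Finset (Formula A At)) (i : RuleTriple A At) : Prop :=
  i.conclusion.IsOver S ∧ ∀ τ ∈ i.premises, τ.IsOver S

open scoped Classical in
/-- The triple is an instance of the right unfolding rule whose principal formula is in focus. -/
def RuleTriple.IsFocusedCommonR {A At : Type*} [Fintype A] (i : RuleTriple A At) : Prop :=
  i.rule = .commonR ∧ ∃ (Γ Δ : Finset (AFormula A At)) (φ : Formula A At),
    i.conclusion.toPreSequent = ⟨Γ, insert (.common φ, .foc) Δ⟩ ∧
    i.premises.map Sequent.toPreSequent = commonRPremises Γ Δ φ .foc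

/-! ### Cyclic proofs -/

/-- Finite trees: a node is either an `openLeaf`, labelled by a sequent and not the conclusion of a
rule, or a node that is the conclusion of a rule triple, with one child for each premise. Axiomatic
leaves are nodes of the second kind with no premise. -/
inductive ProofTree (A At : Type*) : Type _
  | openLeaf (σ : Sequent A At) : ProofTree A At
  | node (i : RuleTriple A At) (child : Fin i.premises.length → ProofTree A At) : ProofTree A At

namespace ProofTree

variable {A At : Type*}

/-- The sequent labelling the root. -/
def label : ProofTree A At → Sequent A At
  | openLeaf σ => σ
  | node i _ => i.conclusion

/-- The subtree at an address. The addresses `p` with `π.subtree p ≠ none` are the nodes of `π`, and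
there is a path from the node `p` to the node `q` if and only if `p` is a prefix of `q`. -/
def subtree : ProofTree A At → List ℕ → Option (ProofTree A At)
  | t, [] => some t
  | openLeaf _, _ :: _ => none
  | node i child, k :: p =>
      if h : k < i.premises.length then (child ⟨k, h⟩).subtree p else none

/-- `π` is a cyclic pre-proof in `P`: its nodes are labelled according to the rules of `P`. -/
def IsPreProof [Fintype A] (P : Calculus) (π : ProofTree A At) : Prop :=
  ∀ p i child, π.subtree p = some (node i child) →
    i.IsInstance P ∧ ∀ k, (child k).label = i.premises.get k

/-- The path from the node `p` to the node `q` is successful. -/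
def SuccessfulPath [Fintype A] (π : ProofTree A At) (p q : List ℕ) : Prop :=
  p <+: q ∧
  (∀ r t, p <+: r → r <+: q → π.subtree r = some t → t.label.HasFocus) ∧
  ∃ r i child, p <+: r ∧ r <+: q ∧ r ≠ q ∧ π.subtree r = some (node i child) ∧
    i.IsFocusedCommonR

/-- The pair of nodes `(p, q)` is a repetition. -/
def IsRepetition (π : ProofTree A At) (p q : List ℕ) : Prop :=
  p ≠ q ∧ p <+: q ∧ ∃ t s, π.subtree p = some t ∧ π.subtree q = some s ∧ t.label = s.label

/-- `π` is a cyclic proof of `σ` in `P`. -/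
structure IsCyclicProof [Fintype A] (P : Calculus) (π : ProofTree A At) (σ : Sequent A At) :
    Prop where
  preProof : π.IsPreProof P
  root : π.label = σ
  companion : ∀ q τ, π.subtree q = some (openLeaf τ) →
    ∃ p, π.IsRepetition p q ∧ π.SuccessfulPath p q

/-- Every sequent that occurs in `π` is an `S`-sequent. -/
def IsOver (S : Finset (Formula A At)) (π : ProofTree A At) : Prop :=
  ∀ p t, π.subtree p = some t → t.label.IsOver S

end ProofTree

/-- The set of `S`-sequents. -/
abbrev SequentOver {A At : Type*} (S : Finset (Formula A At)) : Type _ :=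
  {τ : Sequent A At // τ.IsOver S}

/-- The set of `S`-rule positions in `P`. -/
abbrev RulePosition {A At : Type*} [Fintype A] (P : Calculus) (S : Finset (Formula A At)) :
    Type _ :=
  {i : RuleTriple A At // i.IsInstance P ∧ i.IsOver S}

/-- `π` is uniform: a function assigns to each `S`-sequent the rule instance of which it is the
conclusion at all its occurrences in `π`. A non-axiomatic leaf is not the conclusion of a rule
instance in `π`, but its companions, which carry the same sequent, are. -/
def ProofTree.IsUniform {A At : Type*} [Fintype A] (P : Calculus) (S : Finset (Formula A At))
    (π : ProofTree A At) : Prop :=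
  ∃ g : SequentOver S → RulePosition P S, ∀ p i child, π.subtree p = some (.node i child) →
    ∀ τ : SequentOver S, i.conclusion = τ.1 → (g τ).1 = i

/-- `σ` is `P`-provable. -/
def Provable {A At : Type*} [Fintype A] (P : Calculus) (σ : Sequent A At) : Prop :=
  ∃ π : ProofTree A At, π.IsCyclicProof P σ

/-- `σ` has an `S`-proof in `P`. -/
def HasProofOver {A At : Type*} [Fintype A] (P : Calculus) (S : Finset (Formula A At))
    (σ : Sequent A At) : Prop :=
  ∃ π : ProofTree A At, π.IsCyclicProof P σ ∧ π.IsOver S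

/-- `σ` has a uniform `S`-proof in `P`. -/
def HasUniformProofOver {A At : Type*} [Fintype A] (P : Calculus) (S : Finset (Formula A At))
    (σ : Sequent A At) : Prop :=
  ∃ π : ProofTree A At, π.IsCyclicProof P σ ∧ π.IsOver S ∧ π.IsUniform P S

/-! ### Parity games -/

/-- The two players. -/
inductive Player : Type
  | prover : Player
  | refuter : Player

/-- Parity games with an initial position. -/
structure ParityGame : Type _ where
  Pos : Type*
  start : Pos
  owner : Pos → Player
  move : Pos → Pos → Prop
  priority : Pos → ℕ

namespace ParityGame

/-- The owner of the position has no admissible move. -/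
def DeadEnd (G : ParityGame) (v : G.Pos) : Prop := ∀ w, ¬ G.move v w

/-- The finite plays: sequences `m 0, …, m n` that end in a dead end. -/
structure IsFinitePlay (G : ParityGame) (n : ℕ) (m : Fin (n + 1) → G.Pos) : Prop where
  start : m 0 = G.start
  move : ∀ k : Fin n, G.move (m k.castSucc) (m k.succ)
  deadEnd : G.DeadEnd (m (Fin.last n))

/-- The infinite plays. -/
structure IsInfinitePlay (G : ParityGame) (m : ℕ → G.Pos) : Prop where
  start : m 0 = G.start
  move : ∀ k, G.move (m k) (m (k + 1))

/-- `X` wins the finite play `m`: the dead end belongs to the other player. -/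
def WinsFinite (G : ParityGame) (X : Player) (n : ℕ) (m : Fin (n + 1) → G.Pos) : Prop :=
  G.owner (m (Fin.last n)) ≠ X

/-- `X` wins the infinite play `m`: the highest priority encountered infinitely often is even if
`X` is Prover, and odd if `X` is Refuter. -/
def WinsInfinite (G : ParityGame) (X : Player) (m : ℕ → G.Pos) : Prop :=
  ∃ d, IsGreatest {d | ∃ᶠ k in Filter.atTop, G.priority (m k) = d} d ∧
    match X with
    | .prover => Even d
    | .refuter => Odd d

/-- Memoryless strategies for `X`: partial functions on positions that map each position owned by
`X` to an admissible move if there is one. -/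
def IsMemorylessStrategy (G : ParityGame) (X : Player) (s : G.Pos → Option G.Pos) : Prop :=
  ∀ v, G.owner v = X → (∃ w, G.move v w) → ∃ w, s v = some w ∧ G.move v w

/-- The memoryless strategy `s` for `X` is winning: `X` wins every play in which `s` is used. -/
structure IsWinning (G : ParityGame) (X : Player) (s : G.Pos → Option G.Pos) : Prop where
  finite : ∀ n (m : Fin (n + 1) → G.Pos), G.IsFinitePlay n m →
    (∀ k : Fin n, G.owner (m k.castSucc) = X → s (m k.castSucc) = some (m k.succ)) →
    G.WinsFinite X n m
  infinite : ∀ m : ℕ → G.Pos, G.IsInfinitePlay m →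
    (∀ k, G.owner (m k) = X → s (m k) = some (m (k + 1))) →
    G.WinsInfinite X m

/-- `X` has a memoryless winning strategy. -/
def HasMemorylessWinningStrategy (G : ParityGame) (X : Player) : Prop :=
  ∃ s : G.Pos → Option G.Pos, G.IsMemorylessStrategy X s ∧ G.IsWinning X s

end ParityGame

open scoped Classical in
/-- The proof-search game of the `S`-sequent `σ` and the calculus `P`. -/
noncomputable def proofSearchGame {A At : Type*} [Fintype A] (P : Calculus)
    (S : Finset (Formula A At)) (σ : SequentOver S) : ParityGame where
  Pos := SequentOver S ⊕ RulePosition P S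
  start := .inl σ
  owner
    | .inl _ => .prover
    | .inr _ => .refuter
  move
    | .inl τ, .inr i => i.1.conclusion = τ.1
    | .inr i, .inl τ => τ.1 ∈ i.1.premises
    | _, _ => False
  priority
    | .inl τ => if τ.1.HasFocus then 1 else 3
    | .inr i => if i.1.IsFocusedCommonR then 2 else 1

end ICK

/-!
Whether Prover wins the proof-search game, a parity game on finitely many sequents, is expressed by
a nested fixed point `μZ.νY.μX`. Ranks of the stages of its two least fixed points choose, at each
winning sequent, a rule that makes progress, and this choice is a memoryless winning strategy.
Unravelling it along each branch up to the first successful repetition yields a uniform proof;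
the unravelling terminates because each of its infinite branches would be a play won by Prover.

A cyclic proof cannot contain a refuted sequent if every rule transmits refutations upwards together
with a budget that does not increase along focused sequents and drops at focused right unfoldings:
a refutation chased through the back edges would lower its budget forever. Sequents outside of the
winning region are refuted in this sense, the budget being the stage at which they drop out of `νY`;
hence a cyclic proof over the closed set shows that Prover wins.

The rules other than cut only lead to subformulae, so this settles the calculi without cut. For
`cICKS5` a semantic detour bounds the cuts. Refutations in birelational models are transmitted too,
the budget being the distance to a world that violates the formula below `C`; this gives soundness.
Conversely, if Prover loses, then the subsets of the closed set that are maximal for his not winning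
form a canonical countermodel, where Prover uses cuts on formulae of the closed set only.
-/

namespace ICK

/-! ### Cyclic proofs and their histories -/

namespace ProofTree

variable {A At : Type*}

/-- The rule triples at the proper ancestors of the node with the given address, root first. -/
def trail : ProofTree A At → List ℕ → List (RuleTriple A At)
  | _, [] => []
  | openLeaf _, _ :: _ => []
  | node i child, k :: p =>
      if h : k < i.premises.length then i :: (child ⟨k, h⟩).trail p else []

@[simp]
theorem subtree_nil (t : ProofTree A At) : t.subtree [] = some t := by
  cases t <;> rfl

@[simp]
theorem trail_nil (t : ProofTree A At) : t.trail [] = [] := by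
  cases t <;> rfl

theorem exists_of_subtree_cons {t s : ProofTree A At} {k : ℕ} {p : List ℕ}
    (hs : t.subtree (k :: p) = some s) : ∃ i child, ∃ h : k < i.premises.length,
      t = node i child ∧ (child ⟨k, h⟩).subtree p = some s ∧
        t.trail (k :: p) = i :: (child ⟨k, h⟩).trail p := by
  cases t with
  | openLeaf τ => simp [subtree] at hs
  | node i child =>
    by_cases h : k < i.premises.length
    · exact ⟨i, child, h, rfl, by simpa [subtree, h] using hs, by simp [trail, h]⟩
    · simp [subtree, h] at hs

theorem subtree_append (t : ProofTree A At) (p q : List ℕ) :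
    t.subtree (p ++ q) = (t.subtree p).bind (·.subtree q) := by
  induction p generalizing t with
  | nil => simp
  | cons k p ih =>
    cases t with
    | openLeaf τ => simp [subtree]
    | node i child =>
      by_cases h : k < i.premises.length
      · simpa [subtree, h] using ih _
      · simp [subtree, h]

theorem trail_append {t s : ProofTree A At} {p : List ℕ} (hs : t.subtree p = some s)
    (q : List ℕ) : t.trail (p ++ q) = t.trail p ++ s.trail q := by
  induction p generalizing t with
  | nil => simp_all
  | cons k p ih =>
    obtain ⟨i, child, h, rfl, hs, -⟩ := exists_of_subtree_cons hs
    simp [trail, h, ih hs]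

theorem exists_node_of_isPrefix {t s : ProofTree A At} {p r : List ℕ}
    (hs : t.subtree p = some s) (hr : r <+: p) (hne : r ≠ p) :
    ∃ i child, t.subtree r = some (node i child) ∧ i ∈ t.trail p := by
  obtain ⟨q, rfl⟩ := hr
  obtain ⟨k, q, rfl⟩ := List.exists_cons_of_ne_nil (l := q) (by simpa using hne)
  obtain ⟨u, hu, hus⟩ := Option.bind_eq_some_iff.1 (subtree_append t r (k :: q) ▸ hs)
  obtain ⟨i, child, h, rfl, -, htrail⟩ := exists_of_subtree_cons hus
  exact ⟨i, child, hu, by simp [trail_append hu, htrail]⟩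

theorem exists_of_trail_eq_append {t : ProofTree A At} {p : List ℕ} {i : RuleTriple A At}
    {H₁ H₂ : List (RuleTriple A At)} (h : t.trail p = H₁ ++ i :: H₂) :
    ∃ r q child, p = r ++ q ∧ q ≠ [] ∧ t.subtree r = some (node i child) ∧
      (node i child).trail q = i :: H₂ := by
  induction p generalizing t H₁ with
  | nil => simp at h
  | cons k p ih =>
    cases t with
    | openLeaf τ => simp [trail] at h
    | node j child =>
      by_cases hk : k < j.premises.length
      · rw [trail, dif_pos hk] at h
        cases H₁ with
        | nil =>
          obtain ⟨rfl, hH⟩ := List.cons.inj h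
          exact ⟨[], k :: p, child, rfl, by simp, by simp, by simp [trail, hk, hH]⟩
        | cons j' H₁ =>
          obtain ⟨r, q, child', rfl, hq, hr, htrail⟩ := ih (List.cons.inj h).2
          exact ⟨k :: r, q, child', rfl, hq, by simpa [subtree, hk] using hr, htrail⟩
      · simp [trail, hk] at h

theorem mem_trail_iff {t s : ProofTree A At} {p : List ℕ} (hs : t.subtree p = some s)
    {j : RuleTriple A At} :
    j ∈ t.trail p ↔ ∃ r child, r <+: p ∧ r ≠ p ∧ t.subtree r = some (node j child) := by
  constructor
  · intro hj
    obtain ⟨H₁, H₂, hH⟩ := List.append_of_mem hj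
    obtain ⟨r, q, child, rfl, hq, hr, -⟩ := exists_of_trail_eq_append hH
    exact ⟨r, child, List.prefix_append _ _, by simpa using hq.symm, hr⟩
  · rintro ⟨r, child, hrp, hne, hr⟩
    obtain ⟨i, child', hr', hi⟩ := exists_node_of_isPrefix hs hrp hne
    cases hr.symm.trans hr'
    exact hi

theorem forall_isPrefix_label_iff {t s : ProofTree A At} {p : List ℕ}
    (hs : t.subtree p = some s) {R : Sequent A At → Prop} :
    (∀ r u, r <+: p → t.subtree r = some u → R u.label) ↔
      (∀ j ∈ t.trail p, R j.conclusion) ∧ R s.label := by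
  constructor
  · refine fun h => ⟨fun j hj => ?_, h p s List.prefix_rfl hs⟩
    obtain ⟨r, child, hrp, -, hr⟩ := (mem_trail_iff hs).1 hj
    exact h r _ hrp hr
  · rintro ⟨htrail, hlabel⟩ r u hrp hu
    by_cases hne : r = p
    · cases (hne ▸ hu).symm.trans hs
      exact hlabel
    · obtain ⟨i, child, hr, hi⟩ := exists_node_of_isPrefix hs hrp hne
      cases hu.symm.trans hr
      exact htrail i hi

variable [Fintype A]

theorem successfulPath_append_iff {t u s : ProofTree A At} {p q : List ℕ}
    (hu : t.subtree p = some u) (hs : u.subtree q = some s) :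
    t.SuccessfulPath p (p ++ q) ↔
      ((∀ j ∈ u.trail q, j.conclusion.HasFocus) ∧ s.label.HasFocus) ∧
        ∃ j ∈ u.trail q, j.IsFocusedCommonR := by
  have hsub (r : List ℕ) : t.subtree (p ++ r) = u.subtree r := by simp [subtree_append, hu]
  rw [← forall_isPrefix_label_iff hs, SuccessfulPath, and_iff_right (List.prefix_append p q)]
  refine and_congr ⟨fun h r v hr hv => ?_, ?_⟩ ⟨?_, ?_⟩
  · exact h (p ++ r) v (List.prefix_append _ _) ((List.prefix_append_right_inj p).2 hr)
      ((hsub r).trans hv)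
  · rintro h _ v ⟨r, rfl⟩ hr hv
    exact h r v ((List.prefix_append_right_inj p).1 hr) ((hsub r).symm.trans hv)
  · rintro ⟨_, j, child, ⟨r, rfl⟩, hr, hne, hj, hcommon⟩
    exact ⟨j, (mem_trail_iff hs).2 ⟨r, child, (List.prefix_append_right_inj p).1 hr,
      by simpa using hne, (hsub r).symm.trans hj⟩, hcommon⟩
  · rintro ⟨j, hj, hcommon⟩
    obtain ⟨r, child, hr, hne, hj⟩ := (mem_trail_iff hs).1 hj
    exact ⟨p ++ r, j, child, List.prefix_append _ _, (List.prefix_append_right_inj p).2 hr,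
      by simpa using hne, (hsub r).trans hj, hcommon⟩

/-- A leaf labelled `τ` whose proper ancestors carry the triples `H`, root first, has a companion
and the path from it is successful. -/
def Repeats (H : List (RuleTriple A At)) (τ : Sequent A At) : Prop :=
  ∃ H₁ i H₂, H = H₁ ++ i :: H₂ ∧ i.conclusion = τ ∧
    (∀ j ∈ i :: H₂, j.conclusion.HasFocus) ∧ ∃ j ∈ i :: H₂, j.IsFocusedCommonR

theorem repeats_trail_iff {t : ProofTree A At} {p : List ℕ} {τ : Sequent A At}
    (hp : t.subtree p = some (openLeaf τ)) :
    Repeats (t.trail p) τ ↔ ∃ r, t.IsRepetition r p ∧ t.SuccessfulPath r p := by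
  constructor
  · rintro ⟨H₁, i, H₂, hH, hi, hfocus, hcommon⟩
    obtain ⟨r, q, child, rfl, hq, hr, htrail⟩ := exists_of_trail_eq_append hH
    have hs : (node i child).subtree q = some (openLeaf τ) := by
      simpa [subtree_append, hr] using hp
    refine ⟨r, ⟨by simpa using hq.symm, List.prefix_append _ _, _, _, hr, hp, hi⟩,
      (successfulPath_append_iff hr hs).2 ?_⟩
    rw [htrail]
    exact ⟨⟨hfocus, hi ▸ hfocus i List.mem_cons_self⟩, hcommon⟩
  · rintro ⟨_, ⟨hne, ⟨q, rfl⟩, t', s, ht', hs, hlabel⟩, hsucc⟩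
    cases hs.symm.trans hp
    obtain ⟨k, q, rfl⟩ := List.exists_cons_of_ne_nil (l := q) (by simpa using hne)
    have hs' : t'.subtree (k :: q) = some (openLeaf τ) := by
      simpa [subtree_append, ht'] using hp
    obtain ⟨⟨hfocus, -⟩, hcommon⟩ := (successfulPath_append_iff ht' hs').1 hsucc
    obtain ⟨i, child, h, rfl, -, htrail⟩ := exists_of_subtree_cons hs'
    rw [htrail] at hfocus hcommon
    exact ⟨_, i, _, by rw [trail_append ht', htrail], hlabel, hfocus, hcommon⟩

/-- Trees that are correct below a branch whose triples are `H`, root first: all triples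
satisfy `Q`, labels match, and each open leaf has a companion from which the path is successful.
Unlike `IsCyclicProof` this is defined by recursion on the tree. -/
def Correct (Q : RuleTriple A At → Prop) : List (RuleTriple A At) → ProofTree A At → Prop
  | H, openLeaf τ => Repeats H τ
  | H, node i child => Q i ∧ (∀ k, (child k).label = i.premises.get k) ∧
      ∀ k, Correct Q (H ++ [i]) (child k)

variable {P : Calculus} {Q : RuleTriple A At → Prop} {H : List (RuleTriple A At)}
  {t : ProofTree A At} {σ : Sequent A At}

theorem Correct.subtree (ht : t.Correct Q H) {p : List ℕ} {s : ProofTree A At}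
    (hs : t.subtree p = some s) : s.Correct Q (H ++ t.trail p) := by
  induction p generalizing t H with
  | nil => simp_all
  | cons k p ih =>
    obtain ⟨i, child, h, rfl, hs, htrail⟩ := exists_of_subtree_cons hs
    simpa [htrail] using ih (ht.2.2 ⟨k, h⟩) hs

theorem Correct.isCyclicProof (ht : t.Correct (·.IsInstance P) []) :
    t.IsCyclicProof P t.label where
  preProof _ _ _ hp := ⟨(ht.subtree hp).1, (ht.subtree hp).2.1⟩
  root := rfl
  companion _ _ hp := (repeats_trail_iff hp).1 (ht.subtree hp)

theorem IsCyclicProof.correct (ht : t.IsCyclicProof P σ)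
    (hQ : ∀ p i child, t.subtree p = some (node i child) → Q i) : t.Correct Q [] := by
  suffices key : ∀ (s : ProofTree A At) p, t.subtree p = some s → s.Correct Q (t.trail p) by
    simpa using key t [] (subtree_nil t)
  intro s
  induction s with
  | openLeaf τ => exact fun p hp => (repeats_trail_iff hp).2 (ht.companion p τ hp)
  | node i child ih =>
    refine fun p hp => ⟨hQ p i child hp, (ht.preProof p i child hp).2, fun k => ?_⟩
    have hk : t.subtree (p ++ [k.1]) = some (child k) := by
      simp [subtree_append, hp, ProofTree.subtree]
    simpa [trail_append hp, trail] using ih k _ hk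

theorem Correct.mono {Q' : RuleTriple A At → Prop} (hQ : ∀ i, Q i → Q' i) (ht : t.Correct Q H) :
    t.Correct Q' H := by
  induction t generalizing H with
  | openLeaf τ => exact ht
  | node i child ih => exact ⟨hQ i ht.1, ht.2.1, fun k => ih k (ht.2.2 k)⟩

theorem Correct.isOver {S : Finset (Formula A At)}
    (hQ : ∀ i, Q i → i.conclusion.IsOver S → ∀ τ ∈ i.premises, τ.IsOver S)
    (ht : t.Correct Q H) (hlabel : t.label.IsOver S) : t.IsOver S := by
  intro p
  induction p generalizing t H with
  | nil => simpa using hlabel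
  | cons k p ih =>
    intro s hs
    obtain ⟨i, child, h, rfl, hs, -⟩ := exists_of_subtree_cons hs
    refine ih (ht.2.2 ⟨k, h⟩) ?_ s hs
    rw [ht.2.1]
    exact hQ i ht.1 hlabel _ (List.get_mem _ _)

/-! ### Chasing refutations through a cyclic proof -/

/-- `D n σ` is read as "`σ` is refuted with budget `n`". Every triple in `Q` transmits refutations
from its conclusion to a premise; the budget does not increase along focused sequents and
decreases at focused right unfoldings. -/
def TransmitsRefutations (Q : RuleTriple A At → Prop) (D : ℕ → Sequent A At → Prop) : Prop :=
  ∀ i, Q i → ∀ n, D n i.conclusion → ∃ τ ∈ i.premises, ∃ m, D m τ ∧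
    (i.conclusion.HasFocus → τ.HasFocus → m ≤ n ∧ (i.IsFocusedCommonR → m < n))

/-- A refutation with budget `n` below the history `H` has jumped back to a triple of `H`, from
which on all sequents of `H` have a formula in focus. The budget may have stayed the same only if
a focused right unfolding, which is still going to lower it, lies on the way. -/
def Returns (D : ℕ → Sequent A At → Prop) (H : List (RuleTriple A At)) (n : ℕ) : Prop :=
  ∃ H₁ i H₂, H = H₁ ++ i :: H₂ ∧ (∀ j ∈ i :: H₂, j.conclusion.HasFocus) ∧
    ∃ m ≤ n, D m i.conclusion ∧ ((∀ j ∈ i :: H₂, ¬ j.IsFocusedCommonR) → m < n)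

variable {D : ℕ → Sequent A At → Prop} {m n : ℕ}

theorem Repeats.returns (h : Repeats H σ) (hn : D n σ) : Returns D H n := by
  obtain ⟨H₁, i, H₂, rfl, rfl, hfocus, j, hj, hcommon⟩ := h
  exact ⟨H₁, i, H₂, rfl, hfocus, n, le_rfl, hn, fun hno => absurd hcommon (hno j hj)⟩

theorem Returns.mono (h : Returns D H m) (hmn : m ≤ n) : Returns D H n := by
  obtain ⟨H₁, i, H₂, hH, hfocus, l, hl, hD, hlt⟩ := h
  exact ⟨H₁, i, H₂, hH, hfocus, l, hl.trans hmn, hD, fun hno => (hlt hno).trans_le hmn⟩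

theorem Returns.of_concat {i : RuleTriple A At} (h : Returns D (H ++ [i]) m)
    (hmn : i.conclusion.HasFocus → m ≤ n ∧ (i.IsFocusedCommonR → m < n)) :
    i.conclusion.HasFocus ∧ (Returns D H n ∨ ∃ l < n, D l i.conclusion) := by
  obtain ⟨H₁, j, H₂, hH, hfocus, l, hl, hD, hlt⟩ := h
  obtain rfl | ⟨H₂, j', rfl⟩ := List.eq_nil_or_concat' H₂
  · obtain ⟨rfl, ⟨⟩⟩ := List.append_inj' hH rfl
    have hi := hfocus i List.mem_cons_self
    refine ⟨hi, .inr ⟨l, ?_, hD⟩⟩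
    by_cases hcommon : i.IsFocusedCommonR
    · exact hl.trans_lt ((hmn hi).2 hcommon)
    · exact (hlt (by simpa using hcommon)).trans_le (hmn hi).1
  · rw [← List.cons_append, ← List.append_assoc] at hH
    obtain ⟨rfl, ⟨⟩⟩ := List.append_inj' hH rfl
    have hi := hfocus i (by simp)
    refine ⟨hi, .inl ⟨H₁, j, H₂, rfl, fun j' hj' => hfocus j' ?_, l, hl.trans (hmn hi).1, hD, ?_⟩⟩
    · exact List.mem_append_left [i] hj'
    · intro hno
      by_cases hcommon : i.IsFocusedCommonR
      · exact hl.trans_lt ((hmn hi).2 hcommon)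
      · refine (hlt ?_).trans_le (hmn hi).1
        rw [← List.cons_append, List.forall_mem_append]
        exact ⟨hno, by simpa using hcommon⟩

theorem Correct.returns (hD : TransmitsRefutations Q D) (ht : t.Correct Q H)
    (hn : D n t.label) : t.label.HasFocus ∧ Returns D H n := by
  induction t generalizing H n with
  | openLeaf τ =>
    obtain ⟨_, i, _, -, rfl, hfocus, -⟩ := id ht
    exact ⟨hfocus i List.mem_cons_self, Repeats.returns ht hn⟩
  | node i child ih =>
    induction n using Nat.strong_induction_on with
    | _ n ihn =>
      obtain ⟨τ, hτ, m, hm, hmn⟩ := hD i ht.1 n hn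
      obtain ⟨k, rfl⟩ := List.mem_iff_get.1 hτ
      rw [← ht.2.1 k] at hm hmn
      obtain ⟨hfocus, hreturns⟩ := ih k (ht.2.2 k) hm
      obtain ⟨hi, h | ⟨l, hl, hDl⟩⟩ := hreturns.of_concat fun hi => hmn hi hfocus
      · exact ⟨hi, h⟩
      · exact ⟨hi, (ihn l hl hDl).2.mono hl.le⟩

theorem Correct.not_refuted (hD : TransmitsRefutations Q D) (ht : t.Correct Q []) :
    ¬ D n t.label := by
  intro hn
  obtain ⟨-, H₁, i, H₂, hH, -⟩ := ht.returns hD hn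
  simp at hH

end ProofTree

/-! ### Ranks of fixed points on a finite type -/

section Ranks

theorem iterate_bot_le_lfp {α : Type*} [CompleteLattice α] (f : α →o α) (n : ℕ) :
    f^[n] ⊥ ≤ OrderHom.lfp f := by
  induction n with
  | zero => exact bot_le
  | succ n ih => exact Function.iterate_succ_apply' f n ⊥ ▸ f.map_le_lfp ih

theorem exists_lfp_le_iterate_bot {α : Type*} [CompleteLattice α] [WellFoundedGT α]
    (f : α →o α) : ∃ n, OrderHom.lfp f ≤ f^[n] ⊥ := by
  obtain ⟨n, hn⟩ := WellFoundedGT.monotone_chain_condition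
    (⟨_, f.monotone.monotone_iterate_of_le_map bot_le⟩ : ℕ →o α)
  exact ⟨n, f.lfp_le (Function.iterate_succ_apply' f n ⊥ ▸ (hn (n + 1) n.le_succ).ge)⟩

variable {V : Type*}

/-- The rank of `v` is the stage at which `v` enters the least fixed point. -/
theorem exists_rank_lfp [Finite V] (f : Set V →o Set V) {X : Set V} (hX : OrderHom.lfp f = X) :
    ∃ r : V → ℕ, ∀ v ∈ X, ∀ n, v ∈ f {u | u ∈ X ∧ r u < n} ↔ r v ≤ n := by
  subst hX
  have hmono : Monotone fun n => f^[n] ⊥ := f.monotone.monotone_iterate_of_le_map bot_le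
  let r (v : V) : ℕ := sInf {n | v ∈ f^[n + 1] ⊥}
  have hr (v : V) (hv : v ∈ OrderHom.lfp f) (n : ℕ) : v ∈ f^[n + 1] ⊥ ↔ r v ≤ n := by
    obtain ⟨N, hN⟩ := exists_lfp_le_iterate_bot f
    have hne : {n | v ∈ f^[n + 1] ⊥}.Nonempty := ⟨N, hmono N.le_succ (hN hv)⟩
    exact ⟨fun h => Nat.sInf_le h, fun h => hmono (Nat.succ_le_succ h) (Nat.sInf_mem hne)⟩
  have hstage (n : ℕ) : f^[n] ⊥ = {u | u ∈ OrderHom.lfp f ∧ r u < n} := by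
    ext u
    cases n with
    | zero => simp
    | succ n =>
      exact ⟨fun h => have hu := iterate_bot_le_lfp f _ h
          ⟨hu, Nat.lt_succ_of_le ((hr u hu n).1 h)⟩,
        fun h => (hr u h.1 n).2 (Nat.le_of_lt_succ h.2)⟩
  exact ⟨r, fun v hv n => by rw [← hstage, ← Function.iterate_succ_apply' f n ⊥, hr v hv]⟩

/-- The rank of `v` is the stage at which `v` drops out of the greatest fixed point. -/
theorem exists_rank_gfp [Finite V] (f : Set V →o Set V) {X : Set V} (hX : OrderHom.gfp f = X) :
    ∃ r : V → ℕ, ∀ v ∉ X, ∀ n, v ∉ f {u | u ∉ X → n ≤ r u} ↔ r v ≤ n := by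
  subst hX
  let g : Set V →o Set V := ⟨fun X => (f Xᶜ)ᶜ, fun _ _ h =>
    Set.compl_subset_compl.2 (f.monotone (Set.compl_subset_compl.2 h))⟩
  have hg : OrderHom.lfp g = (OrderHom.gfp f)ᶜ := by
    refine subset_antisymm (g.lfp_le ?_) (Set.compl_subset_comm.1 (f.le_gfp ?_))
    · exact Set.compl_subset_compl.2 (by simp)
    · exact Set.compl_subset_comm.1 g.map_lfp.le
  obtain ⟨r, hr⟩ := exists_rank_lfp g hg
  refine ⟨r, fun v hv n => ?_⟩
  rw [← hr v hv n]
  have hcompl : {u | u ∉ OrderHom.gfp f → n ≤ r u} = {u | u ∈ (OrderHom.gfp f)ᶜ ∧ r u < n}ᶜ := by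
    ext u; simp
  rw [hcompl]
  rfl

end Ranks

/-! ### The winning region of Prover -/

section WinSet

variable {A At : Type*}

instance finite_sequentOver (S : Finset (Formula A At)) : Finite (SequentOver S) := by
  classical
  have : Fintype Ann := ⟨{.unfoc, .foc}, fun b => by cases b <;> simp⟩
  let U : Finset (AFormula A At) := S ×ˢ Finset.univ
  refine Finite.of_injective (β := U.powerset × U.powerset)
    (fun τ => (⟨τ.1.left, ?_⟩, ⟨τ.1.right, ?_⟩)) fun σ τ h => ?_
  · exact Finset.mem_powerset.2 fun x hx =>
      Finset.mem_product.2 ⟨τ.2 x.1 x.2 (.inl hx), Finset.mem_univ _⟩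
  · exact Finset.mem_powerset.2 fun x hx =>
      Finset.mem_product.2 ⟨τ.2 x.1 x.2 (.inr hx), Finset.mem_univ _⟩
  · simp only [Prod.mk.injEq, Subtype.mk.injEq] at h
    exact Subtype.ext (Sequent.ext h.1 h.2)

variable [Fintype A]

namespace RuleTriple

theorem IsFocusedCommonR.hasFocus {i : RuleTriple A At} (h : i.IsFocusedCommonR) :
    i.conclusion.HasFocus := by
  obtain ⟨-, Γ, Δ, φ, hi, -⟩ := h
  exact ⟨.common φ, by simp [hi]⟩

variable {S : Finset (Formula A At)} {X Y Z : Set (SequentOver S)}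

open scoped Classical in
/-- Where the premises of a rule triple have to lie: `Y`, `X` or `Z` according to whether a play
that passes through the triple meets priority `2`, at most `1`, or `3`. -/
noncomputable def target (i : RuleTriple A At) (X Y Z : Set (SequentOver S)) :
    Set (SequentOver S) :=
  if i.IsFocusedCommonR then Y else if i.conclusion.HasFocus then X else Z

theorem target_of_isFocusedCommonR {i : RuleTriple A At} (h : i.IsFocusedCommonR) :
    i.target X Y Z = Y := if_pos h

theorem target_of_hasFocus {i : RuleTriple A At} (h : ¬ i.IsFocusedCommonR)
    (hfocus : i.conclusion.HasFocus) : i.target X Y Z = X := by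
  rw [target, if_neg h, if_pos hfocus]

theorem target_of_not_hasFocus {i : RuleTriple A At} (h : ¬ i.conclusion.HasFocus) :
    i.target X Y Z = Z := by
  rw [target, if_neg fun hcommon => h hcommon.hasFocus, if_neg h]

@[simp]
theorem target_self (i : RuleTriple A At) : i.target X X X = X := by
  simp [target]

theorem target_mono {X' Y' Z' : Set (SequentOver S)} (i : RuleTriple A At) (hX : X ⊆ X')
    (hY : Y ⊆ Y') (hZ : Z ⊆ Z') : i.target X Y Z ⊆ i.target X' Y' Z' := by
  unfold target
  split_ifs <;> assumption

end RuleTriple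

variable (P : Calculus) (S : Finset (Formula A At))

/-- The sequents that are the conclusion of a rule position all of whose premises lie in its
target. -/
def stepSet (X Y Z : Set (SequentOver S)) : Set (SequentOver S) :=
  {τ | ∃ i : RulePosition P S, i.1.conclusion = τ.1 ∧
    ∀ τ' : SequentOver S, τ'.1 ∈ i.1.premises → τ' ∈ i.1.target X Y Z}

theorem stepSet_mono {X X' Y Y' Z Z' : Set (SequentOver S)} (hX : X ⊆ X') (hY : Y ⊆ Y')
    (hZ : Z ⊆ Z') : stepSet P S X Y Z ⊆ stepSet P S X' Y' Z' :=
  fun _ ⟨i, hi, h⟩ => ⟨i, hi, fun τ' hτ' => i.1.target_mono hX hY hZ (h τ' hτ')⟩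

/-- `stepSet` as a monotone function of its first argument. -/
def stepHom (Y Z : Set (SequentOver S)) : Set (SequentOver S) →o Set (SequentOver S) :=
  ⟨fun X => stepSet P S X Y Z, fun _ _ h => stepSet_mono P S h subset_rfl subset_rfl⟩

/-- The sequents from which Prover can force the play, along focused sequents, into a focused right
unfolding with premises in `Y` or into an unfocused sequent with successors in `Z`. -/
def reachSet (Y Z : Set (SequentOver S)) : Set (SequentOver S) := OrderHom.lfp (stepHom P S Y Z)

theorem reachSet_mono {Y Y' Z Z' : Set (SequentOver S)} (hY : Y ⊆ Y') (hZ : Z ⊆ Z') :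
    reachSet P S Y Z ⊆ reachSet P S Y' Z' :=
  OrderHom.lfp.monotone fun _ => stepSet_mono P S subset_rfl hY hZ

/-- `reachSet` as a monotone function of its first argument. -/
def reachHom (Z : Set (SequentOver S)) : Set (SequentOver S) →o Set (SequentOver S) :=
  ⟨fun Y => reachSet P S Y Z, fun _ _ h => reachSet_mono P S h subset_rfl⟩

/-- The sequents from which Prover can force the play into an unfocused sequent with successors in
`Z` or, along focused sequents, through infinitely many focused right unfoldings. -/
def recurSet (Z : Set (SequentOver S)) : Set (SequentOver S) := OrderHom.gfp (reachHom P S Z)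

/-- `recurSet` as a monotone function. -/
def recurHom : Set (SequentOver S) →o Set (SequentOver S) :=
  ⟨recurSet P S, fun _ _ h => OrderHom.gfp.monotone fun _ => reachSet_mono P S subset_rfl h⟩

/-- The winning region of Prover in the proof-search game, as the fixed point `μZ.νY.μX` of the step
function. -/
def winSet : Set (SequentOver S) := OrderHom.lfp (recurHom P S)

theorem stepSet_reachSet (Y Z : Set (SequentOver S)) :
    stepSet P S (reachSet P S Y Z) Y Z = reachSet P S Y Z :=
  (stepHom P S Y Z).map_lfp

theorem reachSet_recurSet (Z : Set (SequentOver S)) :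
    reachSet P S (recurSet P S Z) Z = recurSet P S Z :=
  (reachHom P S Z).map_gfp

theorem recurSet_winSet : recurSet P S (winSet P S) = winSet P S :=
  (recurHom P S).map_lfp

theorem reachSet_winSet : reachSet P S (winSet P S) (winSet P S) = winSet P S := by
  simpa only [recurSet_winSet] using reachSet_recurSet P S (winSet P S)

theorem stepSet_winSet : stepSet P S (winSet P S) (winSet P S) (winSet P S) = winSet P S := by
  simpa only [reachSet_winSet] using stepSet_reachSet P S (winSet P S) (winSet P S)

theorem winSet_subset_reachSet {Y : Set (SequentOver S)} (h : winSet P S ⊆ Y) :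
    winSet P S ⊆ reachSet P S Y (winSet P S) :=
  (reachSet_winSet P S).ge.trans (reachSet_mono P S h subset_rfl)

theorem subset_winSet_of_subset_reachSet {Y : Set (SequentOver S)}
    (h : Y ⊆ reachSet P S (Y ∪ winSet P S) (winSet P S)) : Y ⊆ winSet P S := by
  have hrecur : Y ∪ winSet P S ⊆ recurSet P S (winSet P S) :=
    (reachHom P S (winSet P S)).le_gfp
      (Set.union_subset h (winSet_subset_reachSet P S Set.subset_union_right))
  rw [recurSet_winSet] at hrecur
  exact Set.subset_union_left.trans hrecur

/-- Outside of the winning region, being refuted with budget `n` means dropping out of the greatest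
fixed point at stage `n`. -/
theorem exists_transmitsRefutations_compl_winSet : ∃ r : SequentOver S → ℕ,
    ProofTree.TransmitsRefutations (fun i => i.IsInstance P ∧ i.IsOver S)
      fun n τ => ∃ h : τ.IsOver S, ⟨τ, h⟩ ∉ winSet P S ∧ r ⟨τ, h⟩ = n := by
  set W := winSet P S
  obtain ⟨r, hr⟩ := exists_rank_gfp (reachHom P S W) (recurSet_winSet P S)
  replace hr : ∀ τ ∉ W, ∀ n, τ ∉ reachSet P S {u | u ∉ W → n ≤ r u} W ↔ r τ ≤ n := hr
  refine ⟨r, ?_⟩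
  rintro i hi n ⟨hτ, hτW, rfl⟩
  set Y := {u | u ∉ W → r ⟨i.conclusion, hτ⟩ ≤ r u}
  have hWY : W ⊆ Y := fun u hu hu' => absurd hu hu'
  have hWX : W ⊆ reachSet P S Y W := winSet_subset_reachSet P S hWY
  have hstep := (hr _ hτW _).2 le_rfl
  rw [← stepSet_reachSet] at hstep
  obtain ⟨u, hu, htarget⟩ :
      ∃ u : SequentOver S, u.1 ∈ i.premises ∧ u ∉ i.target (reachSet P S Y W) Y W := by
    by_contra! h
    exact hstep ⟨⟨i, hi⟩, rfl, h⟩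
  have huW : u ∉ W := fun h => htarget (i.target_mono hWX hWY subset_rfl (by simpa using h))
  refine ⟨u.1, hu, r u, ⟨u.2, huW, rfl⟩, fun hfocus _ => ?_⟩
  by_cases hcommon : i.IsFocusedCommonR
  · rw [RuleTriple.target_of_isFocusedCommonR hcommon] at htarget
    have hlt : r u < r ⟨i.conclusion, hτ⟩ := by
      by_contra! h
      exact htarget fun _ => h
    exact ⟨hlt.le, fun _ => hlt⟩
  · rw [RuleTriple.target_of_hasFocus hcommon hfocus] at htarget
    exact ⟨(hr u huW _).1 htarget, fun h => absurd h hcommon⟩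

theorem mem_winSet_of_correct {t : ProofTree A At}
    (ht : t.Correct (fun i => i.IsInstance P ∧ i.IsOver S) []) (hσ : t.label.IsOver S) :
    (⟨t.label, hσ⟩ : SequentOver S) ∈ winSet P S := by
  obtain ⟨r, hr⟩ := exists_transmitsRefutations_compl_winSet P S
  by_contra hnot
  exact ht.not_refuted hr ⟨hσ, hnot, rfl⟩

/-- `a` ranks the outer fixed point; for each of its values, `b` ranks the innermost one. -/
theorem exists_measure : ∃ a b : SequentOver S → ℕ, ∀ τ ∈ winSet P S, τ ∈ stepSet P S
    {u | u ∈ winSet P S ∧ (a u < a τ ∨ a u = a τ ∧ b u < b τ)}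
    {u | u ∈ winSet P S ∧ a u ≤ a τ} {u | u ∈ winSet P S ∧ a u < a τ} := by
  set W := winSet P S
  obtain ⟨a, ha⟩ := exists_rank_lfp (recurHom P S) rfl
  let Z (n : ℕ) : Set (SequentOver S) := {u | u ∈ W ∧ a u < n}
  replace ha : ∀ τ ∈ W, ∀ n, τ ∈ recurSet P S (Z n) ↔ a τ ≤ n := ha
  have hrecur (n : ℕ) : recurSet P S (Z n) ⊆ {u | u ∈ W ∧ a u ≤ n} := fun u hu => by
    have huW : u ∈ W := (recurSet_winSet P S).le ((recurHom P S).monotone (fun _ h => h.1) hu)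
    exact ⟨huW, (ha u huW n).1 hu⟩
  choose b hb using fun n => exists_rank_lfp (stepHom P S (recurSet P S (Z n)) (Z n))
    (reachSet_recurSet P S (Z n))
  replace hb : ∀ n, ∀ τ ∈ recurSet P S (Z n), ∀ m,
      τ ∈ stepSet P S {u | u ∈ recurSet P S (Z n) ∧ b n u < m} (recurSet P S (Z n)) (Z n) ↔
        b n τ ≤ m := hb
  refine ⟨a, fun τ => b (a τ) τ, fun τ hτ => ?_⟩
  refine stepSet_mono P S ?_ (hrecur (a τ)) subset_rfl
    ((hb (a τ) τ ((ha τ hτ _).2 le_rfl) _).2 le_rfl)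
  rintro u ⟨hu, hbu⟩
  obtain ⟨huW, hau⟩ := hrecur _ hu
  exact ⟨huW, hau.lt_or_eq.imp_right fun h => ⟨h, by simpa only [h] using hbu⟩⟩

end WinSet

/-! ### Strategies in parity games -/

theorem exists_finite_path_of_reflTransGen {α : Type*} {r : α → α → Prop} {x y : α}
    (h : Relation.ReflTransGen r x y) : ∃ (n : ℕ) (m : Fin (n + 1) → α),
      m 0 = x ∧ m (Fin.last n) = y ∧ ∀ k : Fin n, r (m k.castSucc) (m k.succ) := by
  induction h using Relation.ReflTransGen.head_induction_on with
  | refl => exact ⟨0, fun _ => y, rfl, rfl, fun k => k.elim0⟩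
  | @head u v huv _ ih =>
    obtain ⟨n, m, rfl, hn, hm⟩ := ih
    refine ⟨n + 1, Fin.cons u m, rfl, hn, Fin.cases huv fun k => ?_⟩
    simpa using hm k

namespace ParityGame

variable {G : ParityGame} {X : Player} {s : G.Pos → Option G.Pos}

/-- The moves of `G` that are possible if `X` uses the memoryless strategy `s`. -/
def Follows (G : ParityGame) (X : Player) (s : G.Pos → Option G.Pos) (v w : G.Pos) : Prop :=
  G.move v w ∧ (G.owner v = X → s v = some w)

theorem isWinning_iff : G.IsWinning X s ↔
    (∀ v, Relation.ReflTransGen (G.Follows X s) G.start v → G.owner v = X → ∃ w, G.move v w) ∧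
      ∀ m : ℕ → G.Pos, m 0 = G.start → (∀ k, G.Follows X s (m k) (m (k + 1))) →
        G.WinsInfinite X m := by
  constructor
  · refine fun h => ⟨fun v hv howner => ?_, fun m hstart hm =>
      h.infinite m ⟨hstart, fun k => (hm k).1⟩ fun k => (hm k).2⟩
    by_contra! hdead
    obtain ⟨n, m, hstart, rfl, hm⟩ := exists_finite_path_of_reflTransGen hv
    exact h.finite n m ⟨hstart, fun k => (hm k).1, hdead⟩ (fun k => (hm k).2) howner
  · refine fun ⟨hmove, hinf⟩ => ⟨fun n m hm hs howner => ?_, fun m hm hs =>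
      hinf m hm.start fun k => ⟨hm.move k, hs k⟩⟩
    have hreach (k : Fin (n + 1)) : Relation.ReflTransGen (G.Follows X s) G.start (m k) := by
      induction k using Fin.induction with
      | zero => exact hm.start ▸ .refl
      | succ k ih => exact ih.tail ⟨hm.move k, hs k⟩
    obtain ⟨w, hw⟩ := hmove _ (hreach _) howner
    exact hm.deadEnd w hw

end ParityGame

/-- The sequence `t 0, i 0, t 1, i 1, …`. -/
def interleave {α β : Type*} (t : ℕ → α) (i : ℕ → β) (k : ℕ) : α ⊕ β :=
  if k % 2 = 0 then .inl (t (k / 2)) else .inr (i (k / 2))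

@[simp]
theorem interleave_two_mul {α β : Type*} (t : ℕ → α) (i : ℕ → β) (k : ℕ) :
    interleave t i (2 * k) = .inl (t k) := by
  simp [interleave]

@[simp]
theorem interleave_two_mul_add_one {α β : Type*} (t : ℕ → α) (i : ℕ → β) (k : ℕ) :
    interleave t i (2 * k + 1) = .inr (i k) := by
  simp [interleave, show (2 * k + 1) / 2 = k by omega]

theorem frequently_atTop_iff_even_or_odd {p : ℕ → Prop} : (∃ᶠ k in Filter.atTop, p k) ↔
    (∃ᶠ k in Filter.atTop, p (2 * k)) ∨ ∃ᶠ k in Filter.atTop, p (2 * k + 1) := by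
  rw [← Filter.frequently_or_distrib]
  constructor
  · refine fun h => Filter.frequently_atTop.2 fun n => ?_
    obtain ⟨k, hk, hp⟩ := Filter.frequently_atTop.1 h (2 * n)
    obtain ⟨j, rfl | rfl⟩ := k.even_or_odd'
    · exact ⟨j, by omega, .inl hp⟩
    · exact ⟨j, by omega, .inr hp⟩
  · refine fun h => Filter.frequently_atTop.2 fun n => ?_
    obtain ⟨k, hk, hp | hp⟩ := Filter.frequently_atTop.1 h n
    exacts [⟨2 * k, by omega, hp⟩, ⟨2 * k + 1, by omega, hp⟩]

section WinningChoice

variable {A At : Type*} [Fintype A] {P : Calculus} {S : Finset (Formula A At)} {σ : SequentOver S}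

section Interleave

variable {t : ℕ → SequentOver S} {i : ℕ → RulePosition P S}

theorem exists_eq_interleave {m : ℕ → SequentOver S ⊕ RulePosition P S} (hstart : m 0 = .inl σ)
    (hm : ∀ k, (proofSearchGame P S σ).move (m k) (m (k + 1))) : ∃ t i, m = interleave t i := by
  have hsequent (k : ℕ) {τ : SequentOver S} (hk : m k = .inl τ) : ∃ j, m (k + 1) = .inr j := by
    have hmove := hm k
    generalize m (k + 1) = w at hmove
    rw [hk] at hmove
    exact w.casesOn (fun _ h => h.elim) (fun j _ => ⟨j, rfl⟩) hmove
  have hrule (k : ℕ) {j : RulePosition P S} (hk : m k = .inr j) : ∃ τ, m (k + 1) = .inl τ := by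
    have hmove := hm k
    generalize m (k + 1) = w at hmove
    rw [hk] at hmove
    exact w.casesOn (fun τ _ => ⟨τ, rfl⟩) (fun _ h => h.elim) hmove
  have heven (k : ℕ) : ∃ τ, m (2 * k) = .inl τ := by
    induction k with
    | zero => exact ⟨σ, hstart⟩
    | succ k ih =>
      obtain ⟨τ, hτ⟩ := ih
      obtain ⟨j, hj⟩ := hsequent _ hτ
      exact hrule _ hj
  choose t ht using heven
  choose i hi using fun k => hsequent _ (ht k)
  refine ⟨t, i, funext fun k => ?_⟩
  obtain ⟨j, rfl | rfl⟩ := k.even_or_odd'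
  · simp [ht]
  · simp [hi]

theorem forall_follows_interleave_iff
    {s : SequentOver S ⊕ RulePosition P S → Option (SequentOver S ⊕ RulePosition P S)} :
    (∀ k, (proofSearchGame P S σ).Follows .prover s (interleave t i k)
        (interleave t i (k + 1))) ↔
      ∀ k, (i k).1.conclusion = (t k).1 ∧ s (.inl (t k)) = some (.inr (i k)) ∧
        (t (k + 1)).1 ∈ (i k).1.premises := by
  constructor
  · intro h k
    have heven := h (2 * k)
    have hodd := h (2 * k + 1)
    rw [show 2 * k + 1 + 1 = 2 * (k + 1) by ring] at hodd
    simp only [interleave_two_mul, interleave_two_mul_add_one] at heven hodd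
    exact ⟨heven.1, heven.2 rfl, hodd.1⟩
  · intro h k
    obtain ⟨j, rfl | rfl⟩ := k.even_or_odd'
    · simp only [interleave_two_mul, interleave_two_mul_add_one]
      exact ⟨(h j).1, fun _ => (h j).2.1⟩
    · rw [show 2 * j + 1 + 1 = 2 * (j + 1) by ring]
      simp only [interleave_two_mul, interleave_two_mul_add_one]
      exact ⟨(h j).2.2, nofun⟩

theorem winsInfinite_interleave_iff :
    (proofSearchGame P S σ).WinsInfinite .prover (interleave t i) ↔
      (∀ᶠ k in Filter.atTop, (t k).1.HasFocus) ∧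
        ∃ᶠ k in Filter.atTop, (i k).1.IsFocusedCommonR := by
  classical
  have hfreq (d : ℕ) : (∃ᶠ k in Filter.atTop,
      (proofSearchGame P S σ).priority (interleave t i k) = d) ↔
        (∃ᶠ k in Filter.atTop, (if (t k).1.HasFocus then 1 else 3) = d) ∨
          ∃ᶠ k in Filter.atTop, (if (i k).1.IsFocusedCommonR then 2 else 1) = d := by
    rw [frequently_atTop_iff_even_or_odd]
    simp only [interleave_two_mul, interleave_two_mul_add_one]
    rfl
  have hthree : (∃ᶠ k in Filter.atTop, (proofSearchGame P S σ).priority (interleave t i k) = 3) ↔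
      ¬ ∀ᶠ k in Filter.atTop, (t k).1.HasFocus := by
    rw [hfreq, Filter.not_eventually]
    simp [ite_eq_iff]
  have htwo : (∃ᶠ k in Filter.atTop, (proofSearchGame P S σ).priority (interleave t i k) = 2) ↔
      ∃ᶠ k in Filter.atTop, (i k).1.IsFocusedCommonR := by
    rw [hfreq]
    simp [ite_eq_iff]
  have hrange {d : ℕ} (hd : ∃ᶠ k in Filter.atTop,
      (proofSearchGame P S σ).priority (interleave t i k) = d) : d = 1 ∨ d = 2 ∨ d = 3 := by
    obtain h | h := (hfreq d).1 hd <;> obtain ⟨k, hk⟩ := h.exists <;> split_ifs at hk <;> omega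
  constructor
  · rintro ⟨d, ⟨hd, hmax⟩, heven⟩
    replace heven : Even d := heven
    obtain rfl : d = 2 := by
      obtain rfl | rfl | rfl := hrange hd
      exacts [absurd heven (by decide), rfl, absurd heven (by decide)]
    exact ⟨by_contra fun h => absurd (hmax (hthree.2 h)) (by decide), htwo.1 hd⟩
  · refine fun ⟨hfocus, hcommon⟩ => ⟨2, ⟨htwo.2 hcommon, fun d hd => ?_⟩, even_two⟩
    obtain rfl | rfl | rfl := hrange hd
    exacts [by decide, le_rfl, absurd hfocus (hthree.1 hd)]

end Interleave

/-! ### Winning choices of rules -/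

/-- `τ'` is a premise of the rule position that `g` assigns to `τ`. -/
def Successor (g : SequentOver S → RulePosition P S) (τ τ' : SequentOver S) : Prop :=
  τ'.1 ∈ (g τ).1.premises

/-- Prover wins from `σ` by always moving to the rule position that `g` assigns to the current
sequent. This is a memoryless winning strategy without the moves at rule positions and at
unreachable sequents. -/
structure IsWinningChoice (g : SequentOver S → RulePosition P S) (σ : SequentOver S) : Prop where
  conclusion : ∀ τ, Relation.ReflTransGen (Successor g) σ τ → (g τ).1.conclusion = τ.1
  infinite : ∀ t : ℕ → SequentOver S, t 0 = σ → (∀ k, Successor g (t k) (t (k + 1))) →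
    (∀ᶠ k in Filter.atTop, (t k).1.HasFocus) ∧
      ∃ᶠ k in Filter.atTop, (g (t k)).1.IsFocusedCommonR

theorem eventually_hasFocus_and_frequently_isFocusedCommonR
    {g : SequentOver S → RulePosition P S} {a b : SequentOver S → ℕ} {t : ℕ → SequentOver S}
    (h : ∀ k, t (k + 1) ∈ (g (t k)).1.target {u | a u < a (t k) ∨ a u = a (t k) ∧ b u < b (t k)}
      {u | a u ≤ a (t k)} {u | a u < a (t k)})
    (hconclusion : ∀ k, (g (t k)).1.conclusion = (t k).1) :
    (∀ᶠ k in Filter.atTop, (t k).1.HasFocus) ∧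
      ∃ᶠ k in Filter.atTop, (g (t k)).1.IsFocusedCommonR := by
  have hanti : Antitone fun k => a (t k) := antitone_nat_of_succ_le fun k => by
    have := h k
    unfold RuleTriple.target at this
    split_ifs at this
    exacts [this, this.elim le_of_lt fun h => h.1.le, le_of_lt this]
  obtain ⟨N, hN⟩ := WellFoundedLT.antitone_chain_condition hanti
  have hconst (k : ℕ) (hk : N ≤ k) : a (t (k + 1)) = a (t k) :=
    (hN (k + 1) (by omega)).symm.trans (hN k hk)
  have hfocus (k : ℕ) (hk : N ≤ k) : (t k).1.HasFocus := by
    by_contra hno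
    have := h k
    rw [RuleTriple.target_of_not_hasFocus (by rwa [hconclusion])] at this
    exact this.ne (hconst k hk)
  refine ⟨Filter.eventually_atTop.2 ⟨N, hfocus⟩, fun hno => ?_⟩
  obtain ⟨M, hM⟩ := Filter.eventually_atTop.1 hno
  refine not_strictAnti_of_wellFoundedLT (fun k => b (t (max M N + k)))
    (strictAnti_nat_of_succ_lt fun k => ?_)
  have := h (max M N + k)
  rw [RuleTriple.target_of_hasFocus (hM _ (by omega))
    (by rw [hconclusion]; exact hfocus _ (by omega))] at this
  exact (this.resolve_left (hconst _ (by omega)).not_lt).2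

theorem exists_isWinningChoice_of_mem_winSet (hσ : σ ∈ winSet P S) :
    ∃ g : SequentOver S → RulePosition P S, IsWinningChoice g σ := by
  obtain ⟨a, b, h⟩ := exists_measure P S
  have : Nonempty (RulePosition P S) := ⟨(h σ hσ).choose⟩
  choose! g hconclusion htarget using h
  have hwin : ∀ τ ∈ winSet P S, ∀ τ', Successor g τ τ' → τ' ∈ winSet P S := fun τ hτ τ' h => by
    have := (g τ).1.target_mono (fun _ h => h.1) (fun _ h => h.1) (fun _ h => h.1)
      (htarget τ hτ τ' h)
    rwa [RuleTriple.target_self] at this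
  have hreach (τ : SequentOver S) (h : Relation.ReflTransGen (Successor g) σ τ) :
      τ ∈ winSet P S := by
    induction h with
    | refl => exact hσ
    | tail _ h ih => exact hwin _ ih _ h
  refine ⟨g, fun τ h => hconclusion τ (hreach τ h), fun t hstart ht => ?_⟩
  have ht_mem (k : ℕ) : t k ∈ winSet P S := by
    induction k with
    | zero => rwa [hstart]
    | succ k ih => exact hwin _ ih _ (ht k)
  exact eventually_hasFocus_and_frequently_isFocusedCommonR
    (fun k => (g (t k)).1.target_mono (fun _ h => h.2) (fun _ h => h.2) (fun _ h => h.2)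
      (htarget _ (ht_mem k) _ (ht k))) fun k => hconclusion _ (ht_mem k)

theorem exists_memorylessStrategy_forall_reachable {g : SequentOver S → RulePosition P S}
    (hg : IsWinningChoice g σ) :
    ∃ s, (proofSearchGame P S σ).IsMemorylessStrategy .prover s ∧
      ∀ τ, Relation.ReflTransGen (Successor g) σ τ → s (.inl τ) = some (.inr (g τ)) := by
  classical
  have hmove (v : (proofSearchGame P S σ).Pos) : ∃ w : Option (proofSearchGame P S σ).Pos,
      ((∃ w, (proofSearchGame P S σ).move v w) →
        ∃ w', w = some w' ∧ (proofSearchGame P S σ).move v w') ∧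
      ∀ τ, v = .inl τ → Relation.ReflTransGen (Successor g) σ τ → w = some (.inr (g τ)) := by
    by_cases hv : ∃ τ, v = .inl τ ∧ Relation.ReflTransGen (Successor g) σ τ
    · obtain ⟨τ, rfl, hτ⟩ := hv
      refine ⟨some (.inr (g τ)), fun _ => ⟨_, rfl, hg.conclusion τ hτ⟩, ?_⟩
      rintro _ ⟨⟩ -
      rfl
    · refine ⟨if h : ∃ w, (proofSearchGame P S σ).move v w then some h.choose else none,
        fun h => ⟨_, dif_pos h, h.choose_spec⟩, fun τ hτ hreach => absurd ⟨τ, hτ, hreach⟩ hv⟩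
  choose s hs hsg using hmove
  exact ⟨s, fun v _ h => hs v h, fun τ hτ => hsg _ τ rfl hτ⟩

theorem IsWinningChoice.hasMemorylessWinningStrategy {g : SequentOver S → RulePosition P S}
    (hg : IsWinningChoice g σ) :
    (proofSearchGame P S σ).HasMemorylessWinningStrategy .prover := by
  obtain ⟨s, hs, hsg⟩ := exists_memorylessStrategy_forall_reachable hg
  refine ⟨s, hs, ParityGame.isWinning_iff.2 ⟨fun v hv howner => ?_, fun m hstart hm => ?_⟩⟩
  · have hinv : v.elim (Relation.ReflTransGen (Successor g) σ)
        fun i => ∃ τ, Relation.ReflTransGen (Successor g) σ τ ∧ i = g τ := by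
      clear howner
      induction hv with
      | refl => exact .refl
      | @tail v w _ h ih =>
        obtain τ | i := v <;> obtain τ' | i' := w
        · exact h.1.elim
        · exact ⟨τ, ih, (Sum.inr.inj (Option.some.inj ((hsg τ ih).symm.trans (h.2 rfl)))).symm⟩
        · obtain ⟨τ, hτ, rfl⟩ := ih
          exact hτ.tail h.1
        · exact h.1.elim
    obtain τ | i := v
    · exact ⟨.inr (g τ), hg.conclusion τ hinv⟩
    · cases howner
  · obtain ⟨t, i, rfl⟩ := exists_eq_interleave hstart fun k => (hm k).1
    replace hm := forall_follows_interleave_iff.1 hm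
    have hzero : t 0 = σ := Sum.inl.inj hstart
    have hchoice {k : ℕ} (h : Relation.ReflTransGen (Successor g) σ (t k)) : i k = g (t k) :=
      Sum.inr.inj (Option.some.inj ((hm k).2.1.symm.trans (hsg _ h)))
    have hreach (k : ℕ) : Relation.ReflTransGen (Successor g) σ (t k) := by
      induction k with
      | zero => exact hzero ▸ .refl
      | succ k ih => exact ih.tail (hchoice ih ▸ (hm k).2.2 :)
    obtain rfl : i = fun k => g (t k) := funext fun k => hchoice (hreach k)
    exact winsInfinite_interleave_iff.2 (hg.infinite t hzero fun k => (hm k).2.2)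

theorem exists_isWinningChoice_of_hasMemorylessWinningStrategy
    (h : (proofSearchGame P S σ).HasMemorylessWinningStrategy .prover) :
    ∃ g : SequentOver S → RulePosition P S, IsWinningChoice g σ := by
  obtain ⟨s, hs, hwin⟩ := h
  obtain ⟨hmove, hinf⟩ := ParityGame.isWinning_iff.1 hwin
  let Reachable (τ : SequentOver S) : Prop := Relation.ReflTransGen
    ((proofSearchGame P S σ).Follows .prover s) (.inl σ) (.inl τ)
  have hchoice (τ : SequentOver S) (hτ : Reachable τ) :
      ∃ i : RulePosition P S, s (.inl τ) = some (.inr i) ∧ i.1.conclusion = τ.1 := by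
    obtain ⟨τ' | i, hw, hw'⟩ := hs (.inl τ) rfl (hmove _ hτ rfl)
    · exact hw'.elim
    · exact ⟨i, hw, hw'⟩
  have : Nonempty (RulePosition P S) := ⟨(hchoice σ .refl).choose⟩
  choose! g hsg hconclusion using hchoice
  have hstep {τ τ' : SequentOver S} (hτ : Reachable τ) (h : Successor g τ τ') : Reachable τ' := by
    have hrule : (proofSearchGame P S σ).Follows .prover s (.inl τ) (.inr (g τ)) :=
      ⟨hconclusion τ hτ, fun _ => hsg τ hτ⟩
    have hpremise : (proofSearchGame P S σ).Follows .prover s (.inr (g τ)) (.inl τ') :=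
      ⟨h, nofun⟩
    exact (hτ.tail hrule).tail hpremise
  refine ⟨g, fun τ hτ => hconclusion τ ?_, fun t hstart ht => ?_⟩
  · induction hτ with
    | refl => exact .refl
    | tail _ h ih => exact hstep ih h
  · have hreach (k : ℕ) : Reachable (t k) := by
      induction k with
      | zero => exact hstart ▸ .refl
      | succ k ih => exact hstep ih (ht k)
    refine winsInfinite_interleave_iff.1 (hinf _ (congrArg Sum.inl hstart) ?_)
    exact forall_follows_interleave_iff.2 fun k =>
      ⟨hconclusion _ (hreach k), hsg _ (hreach k), ht k⟩

/-! ### Uniform proofs from winning choices -/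

theorem exists_eq_and_forall_Ico_and_exists_Ico {α : Type*} [Finite α] {t : ℕ → α} {p q : ℕ → Prop}
    (hp : ∀ᶠ k in Filter.atTop, p k) (hq : ∃ᶠ k in Filter.atTop, q k) :
    ∃ m n, t m = t n ∧ (∀ k ∈ Set.Ico m n, p k) ∧ ∃ k ∈ Set.Ico m n, q k := by
  obtain ⟨N, hN⟩ := Filter.eventually_atTop.1 hp
  obtain ⟨x, hx⟩ := Finite.exists_infinite_fiber t
  replace hx : (t ⁻¹' {x}).Infinite := Set.infinite_coe_iff.1 hx
  obtain ⟨m, hm, hNm⟩ := hx.exists_gt N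
  obtain ⟨k, hmk, hqk⟩ := Filter.frequently_atTop.1 hq m
  obtain ⟨n, hn, hkn⟩ := hx.exists_gt k
  exact ⟨m, n, hm.trans hn.symm, fun j hj => hN j (hNm.le.trans hj.1), k, ⟨hmk, hkn⟩, hqk⟩

/-- One step of the unravelling of a choice of rules into a tree: from a branch with its last label
to the branch extended by the chosen rule, unless the branch is closed by a repetition. -/
def Unravels (g : SequentOver S → RulePosition P S)
    (x y : List (RuleTriple A At) × SequentOver S) : Prop :=
  ¬ ProofTree.Repeats x.1 x.2.1 ∧ Successor g x.2 y.2 ∧ y.1 = x.1 ++ [(g x.2).1]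

theorem IsWinningChoice.exists_repeats {g : SequentOver S → RulePosition P S}
    (hg : IsWinningChoice g σ) {t : ℕ → SequentOver S} (hstart : t 0 = σ)
    (ht : ∀ k, Successor g (t k) (t (k + 1))) :
    ∃ n, ProofTree.Repeats ((List.Ico 0 n).map fun k => (g (t k)).1) (t n).1 := by
  have hconclusion (k : ℕ) : (g (t k)).1.conclusion = (t k).1 := by
    refine hg.conclusion _ ?_
    induction k with
    | zero => exact hstart ▸ .refl
    | succ k ih => exact ih.tail (ht k)
  obtain ⟨hfocus, hcommon⟩ := hg.infinite t hstart ht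
  obtain ⟨m, n, hmn, hfocus, k, hk, hcommon⟩ :=
    exists_eq_and_forall_Ico_and_exists_Ico (t := t) hfocus hcommon
  have hlt : m < n := hk.1.trans_lt hk.2
  have hcons : (List.Ico m n).map (fun k => (g (t k)).1) =
      (g (t m)).1 :: (List.Ico (m + 1) n).map fun k => (g (t k)).1 := by
    rw [List.Ico.eq_cons hlt, List.map_cons]
  refine ⟨n, (List.Ico 0 m).map fun k => (g (t k)).1, (g (t m)).1,
    (List.Ico (m + 1) n).map fun k => (g (t k)).1, ?_,
    (hconclusion m).trans (congrArg Subtype.val hmn), ?_⟩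
  · rw [← hcons, ← List.map_append, List.Ico.append_consecutive m.zero_le hlt.le]
  · rw [← hcons]
    refine ⟨fun j hj => ?_, _, List.mem_map_of_mem (List.Ico.mem.2 hk), hcommon⟩
    obtain ⟨k, hk, rfl⟩ := List.mem_map.1 hj
    exact hconclusion k ▸ hfocus k (List.Ico.mem.1 hk)

theorem IsWinningChoice.acc_unravels {g : SequentOver S → RulePosition P S}
    (hg : IsWinningChoice g σ) : Acc (flip (Unravels g)) ([], σ) := by
  by_contra hnot
  obtain ⟨x, hx, hdesc⟩ := not_acc_iff_exists_descending_chain.1 hnot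
  have hhist (k : ℕ) : (x k).1 = (List.Ico 0 k).map fun j => (g (x j).2).1 := by
    induction k with
    | zero => simp [hx]
    | succ k ih => rw [(hdesc k).2.2, ih, List.Ico.succ_top k.zero_le, List.map_append]; rfl
  obtain ⟨n, hn⟩ := hg.exists_repeats (t := fun k => (x k).2) (congrArg Prod.snd hx)
    fun k => (hdesc k).2.1
  exact (hdesc n).1 (hhist n ▸ hn)

/-- `i` is the rule position that `g` assigns to the conclusion of `i`. -/
def IsChosenBy (g : SequentOver S → RulePosition P S) (i : RuleTriple A At) : Prop :=
  ∃ τ : SequentOver S, (g τ).1 = i ∧ i.conclusion = τ.1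

theorem exists_correct_of_acc_unravels {g : SequentOver S → RulePosition P S}
    (hg : ∀ τ, Relation.ReflTransGen (Successor g) σ τ → (g τ).1.conclusion = τ.1)
    {x : List (RuleTriple A At) × SequentOver S} (hx : Acc (flip (Unravels g)) x)
    (hreach : Relation.ReflTransGen (Successor g) σ x.2) :
    ∃ t : ProofTree A At, t.label = x.2.1 ∧ t.Correct (IsChosenBy g) x.1 := by
  induction hx with
  | intro x _ ih =>
    by_cases hrep : ProofTree.Repeats x.1 x.2.1
    · exact ⟨.openLeaf x.2.1, rfl, hrep⟩
    · have hchild (k : Fin (g x.2).1.premises.length) : ∃ t : ProofTree A At,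
          t.label = (g x.2).1.premises.get k ∧ t.Correct (IsChosenBy g) (x.1 ++ [(g x.2).1]) :=
        have hk := List.get_mem (g x.2).1.premises k
        ih (x.1 ++ [(g x.2).1], ⟨_, (g x.2).2.2.2 _ hk⟩) ⟨hrep, hk, rfl⟩ (hreach.tail hk)
      choose child hlabel hcorrect using hchild
      exact ⟨.node (g x.2).1 child, hg _ hreach, ⟨x.2, rfl, hg _ hreach⟩, hlabel, hcorrect⟩

theorem IsWinningChoice.hasUniformProofOver {g : SequentOver S → RulePosition P S}
    (hg : IsWinningChoice g σ) : HasUniformProofOver P S σ.1 := by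
  obtain ⟨t, hlabel, ht⟩ := exists_correct_of_acc_unravels hg.conclusion hg.acc_unravels .refl
  replace hlabel : t.label = σ.1 := hlabel
  refine ⟨t, hlabel ▸ (ht.mono ?_).isCyclicProof, ht.isOver ?_ (hlabel ▸ σ.2), g, ?_⟩
  · rintro _ ⟨τ, rfl, -⟩
    exact (g τ).2.1
  · rintro _ ⟨τ, rfl, -⟩ -
    exact (g τ).2.2.2
  · intro p i child hp τ hτ
    obtain ⟨⟨τ', rfl, hτ'⟩, -⟩ := ht.subtree hp
    rw [Subtype.ext (hτ.symm.trans hτ')]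

end WinningChoice

/-! ### Analyticity without cut -/

section Analyticity

variable {A At : Type*}

/-- All formulae of the pair, stripped of annotations, belong to `S`. -/
def PreSequent.IsOver (S : Set (Formula A At)) (σ : PreSequent A At) : Prop :=
  (∀ x ∈ σ.left, x.1 ∈ S) ∧ ∀ x ∈ σ.right, x.1 ∈ S

theorem Sequent.isOver_iff {S : Finset (Formula A At)} {σ : Sequent A At} :
    σ.IsOver S ↔ σ.toPreSequent.IsOver S :=
  ⟨fun h => ⟨fun x hx => h x.1 x.2 (.inl hx), fun x hx => h x.1 x.2 (.inr hx)⟩,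
    fun h φ b hφ => hφ.elim (h.1 (φ, b)) (h.2 (φ, b))⟩

theorem Calculus.IsClosed.isClosedSet {P : Calculus} {S : Set (Formula A At)}
    (h : P.IsClosed S) : IsClosedSet S := by
  cases P
  exacts [h, h, h, IsNegClosedSet.toIsClosedSet h]

theorem Calculus.not_hasRule_cut {P : Calculus} (hP : P ≠ .cICKS5) :
    ¬ P.HasRule (.cut : RuleName A) := by
  cases P
  exacts [id, id, id, absurd rfl hP]

variable [Fintype A]

theorem Rule.premises_isOver {r : RuleName A} {σ : PreSequent A At} {l : List (PreSequent A At)}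
    (h : Rule r σ l) (hcut : r ≠ .cut) {S : Set (Formula A At)} (hS : IsClosedSet S)
    (hσ : σ.IsOver S) : ∀ τ ∈ l, τ.IsOver S := by
  have hand := hS.and_mem
  have hor := hS.or_mem
  have himp := hS.imp_mem
  have hknow := hS.know_mem
  have hcommon := hS.common_mem
  cases h <;> first
    | exact absurd rfl hcut
    | simp only [PreSequent.IsOver, knowSet, commonRPremises, Finset.forall_mem_insert,
        Finset.forall_mem_union, Finset.forall_mem_image, Finset.mem_singleton, Finset.mem_univ,
        Finset.mem_toList, List.forall_mem_cons, List.forall_mem_map, List.not_mem_nil, forall_eq,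
        forall_true_left] at *
      grind

theorem ProofTree.IsCyclicProof.correct_isOver {P : Calculus} {S : Finset (Formula A At)}
    {t : ProofTree A At} {σ : Sequent A At} (ht : t.IsCyclicProof P σ) (hS : t.IsOver S) :
    t.Correct (fun i => i.IsInstance P ∧ i.IsOver S) [] := by
  refine ht.correct fun p i child hp => ?_
  obtain ⟨hi, hlabel⟩ := ht.preProof p i child hp
  refine ⟨hi, hS p _ hp, fun τ hτ => ?_⟩
  obtain ⟨k, rfl⟩ := List.mem_iff_get.1 hτ
  have hk : t.subtree (p ++ [k.1]) = some (child k) := by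
    simp [subtree_append, hp, ProofTree.subtree]
  exact hlabel k ▸ hS _ _ hk

theorem ProofTree.IsCyclicProof.isOver {P : Calculus} (hP : P ≠ .cICKS5)
    {S : Finset (Formula A At)} (hS : IsClosedSet (S : Set (Formula A At))) {t : ProofTree A At}
    {σ : Sequent A At} (ht : t.IsCyclicProof P σ) (hσ : σ.IsOver S) : t.IsOver S := by
  have hcorrect := ht.correct (Q := (·.IsInstance P)) fun p i child hp =>
    (ht.preProof p i child hp).1
  refine hcorrect.isOver (fun i hi hconclusion τ hτ => ?_) (ht.root ▸ hσ)
  rw [Sequent.isOver_iff] at hconclusion ⊢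
  exact hi.2.premises_isOver (fun h => Calculus.not_hasRule_cut hP (h ▸ hi.1)) hS hconclusion _
    (List.mem_map_of_mem hτ)

theorem HasProofOver.mem_winSet {P : Calculus} {S : Finset (Formula A At)} {σ : SequentOver S}
    (h : HasProofOver P S σ.1) : σ ∈ winSet P S := by
  obtain ⟨t, ht, hS⟩ := h
  have hlabel : t.label.IsOver S := ht.root ▸ σ.2
  have hmem := mem_winSet_of_correct P S (ht.correct_isOver hS) hlabel
  rwa [show (⟨t.label, hlabel⟩ : SequentOver S) = σ from Subtype.ext ht.root] at hmem

theorem Provable.hasProofOver {P : Calculus} (hP : P ≠ .cICKS5) {S : Finset (Formula A At)}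
    (hS : IsClosedSet (S : Set (Formula A At))) {σ : Sequent A At} (hσ : σ.IsOver S)
    (h : Provable P σ) : HasProofOver P S σ :=
  let ⟨t, ht⟩ := h
  ⟨t, ht, ht.isOver hP hS hσ⟩

end Analyticity

/-! ### Birelational models and soundness -/

section CommonRPremises

variable {A At : Type*} [Fintype A] {Γ Δ : Finset (AFormula A At)} {φ : Formula A At} {b : Ann}
  {p : PreSequent A At → Prop}

open scoped Classical in
theorem exists_mem_commonRPremises :
    (∃ τ ∈ commonRPremises Γ Δ φ b, p τ) ↔ p ⟨Γ, insert (φ, .unfoc) Δ⟩ ∨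
      ∃ a, p ⟨Γ, insert (.know a (.common φ), b) Δ⟩ := by
  simp [commonRPremises]

open scoped Classical in
theorem forall_mem_commonRPremises :
    (∀ τ ∈ commonRPremises Γ Δ φ b, p τ) ↔ p ⟨Γ, insert (φ, .unfoc) Δ⟩ ∧
      ∀ a, p ⟨Γ, insert (.know a (.common φ), b) Δ⟩ := by
  simp [commonRPremises]

end CommonRPremises

/-- Birelational models on a preorder of worlds, in which the accessibility relations are
equivalence relations that contain the order. -/
structure Model (A At W : Type*) [Preorder W] where
  rel : A → W → W → Prop
  val : At → W → Prop
  equivalence : ∀ a, Equivalence (rel a)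
  rel_of_le : ∀ a {v w}, v ≤ w → rel a v w
  val_mono : ∀ p {v w}, v ≤ w → val p v → val p w

namespace Model

variable {A At W : Type*} [Preorder W]

/-- One world is accessible from the other for some agent. -/
def Linked (M : Model A At W) (v w : W) : Prop :=
  ∃ a, M.rel a v w

/-- Truth of a formula at a world. -/
def Sat (M : Model A At W) : Formula A At → W → Prop
  | .bot, _ => False
  | .atom p, w => M.val p w
  | .and φ ψ, w => M.Sat φ w ∧ M.Sat ψ w
  | .or φ ψ, w => M.Sat φ w ∨ M.Sat ψ w
  | .imp φ ψ, w => ∀ v, w ≤ v → M.Sat φ v → M.Sat ψ v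
  | .know a φ, w => ∀ v, M.rel a w v → M.Sat φ v
  | .common φ, w => ∀ v, Relation.ReflTransGen M.Linked w v → M.Sat φ v

/-- Some world that violates `φ` is reached from the given world in `n` steps. -/
def FailsIn (M : Model A At W) (φ : Formula A At) : ℕ → W → Prop
  | 0, w => ¬ M.Sat φ w
  | n + 1, w => ∃ v, M.Linked w v ∧ M.FailsIn φ n v

/-- The annotated formula is false at the world. For a formula `C φ` or `K_a C φ` in focus, this is
due to a world violating `φ` that is reached in `n` steps, not counting the step for `K_a`. -/
def Rejects (M : Model A At W) (n : ℕ) (w : W) : AFormula A At → Prop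
  | (φ, .unfoc) => ¬ M.Sat φ w
  | (.common φ, .foc) => M.FailsIn φ n w
  | (.know a (.common φ), .foc) => ∃ v, M.rel a w v ∧ M.FailsIn φ n v
  | (_, .foc) => False

/-- The world satisfies the antecedent and rejects the succedent, with budget `n`. -/
def Refutes (M : Model A At W) (n : ℕ) (w : W) (σ : PreSequent A At) : Prop :=
  (∀ x ∈ σ.left, M.Sat x.1 w) ∧ ∀ x ∈ σ.right, M.Rejects n w x

variable {M : Model A At W} {a : A} {φ ψ : Formula A At} {v w : W} {m n : ℕ}

theorem Sat.mono [Nonempty A] (hvw : v ≤ w) (h : M.Sat φ v) : M.Sat φ w := by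
  induction φ with
  | bot => exact h
  | atom p => exact M.val_mono p hvw h
  | and φ ψ ih₁ ih₂ => exact ⟨ih₁ h.1, ih₂ h.2⟩
  | or φ ψ ih₁ ih₂ => exact h.imp ih₁ ih₂
  | imp φ ψ => exact fun u hu => h u (hvw.trans hu)
  | know a φ => exact fun u hu => h u ((M.equivalence a).trans (M.rel_of_le a hvw) hu)
  | common φ => exact fun u hu => h u (hu.head ⟨Classical.arbitrary A, M.rel_of_le _ hvw⟩)

theorem sat_know_iff_of_rel (h : M.rel a v w) : M.Sat (.know a φ) v ↔ M.Sat (.know a φ) w :=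
  ⟨fun hv u hu => hv u ((M.equivalence a).trans h hu),
    fun hw u hu => hw u ((M.equivalence a).trans ((M.equivalence a).symm h) hu)⟩

theorem sat_of_sat_know (h : M.Sat (.know a φ) w) : M.Sat φ w :=
  h w ((M.equivalence a).refl w)

theorem sat_of_sat_imp (h : M.Sat (.imp φ ψ) w) (hφ : M.Sat φ w) : M.Sat ψ w :=
  h w le_rfl hφ

theorem sat_know_imp_iff [Nonempty A] :
    M.Sat (.imp (.know a φ) ψ) w ↔ (M.Sat (.know a φ) w → M.Sat ψ w) := by
  refine ⟨sat_of_sat_imp, fun h v hv hφ => (h ?_).mono hv⟩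
  exact (sat_know_iff_of_rel (M.rel_of_le a hv)).2 hφ

theorem sat_common_iff :
    M.Sat (.common φ) w ↔ M.Sat φ w ∧ ∀ a, M.Sat (.know a (.common φ)) w := by
  constructor
  · exact fun h => ⟨h w .refl, fun a v hv u hu => h u (hu.head ⟨a, hv⟩)⟩
  · rintro ⟨hφ, hknow⟩ v hv
    obtain rfl | ⟨u, ⟨a, hu⟩, huv⟩ := hv.cases_head
    · exact hφ
    · exact hknow a u hu v huv

theorem not_sat_common_iff : ¬ M.Sat (.common φ) w ↔ ∃ n, M.FailsIn φ n w := by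
  constructor
  · intro h
    simp only [Sat, not_forall] at h
    obtain ⟨v, hv, hφ⟩ := h
    induction hv using Relation.ReflTransGen.head_induction_on with
    | refl => exact ⟨0, hφ⟩
    | head hlinked _ ih =>
      obtain ⟨n, hn⟩ := ih
      exact ⟨n + 1, _, hlinked, hn⟩
  · rintro ⟨n, hn⟩
    induction n generalizing w with
    | zero => exact fun h => hn (sat_common_iff.1 h).1
    | succ n ih =>
      obtain ⟨v, ⟨a, hv⟩, hn⟩ := hn
      exact fun h => ih hn ((sat_common_iff.1 h).2 a v hv)

theorem Rejects.not_sat {x : AFormula A At} (h : M.Rejects n w x) : ¬ M.Sat x.1 w := by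
  match x with
  | (_, .unfoc) => exact h
  | (.common φ, .foc) => exact not_sat_common_iff.2 ⟨n, h⟩
  | (.know a (.common φ), .foc) =>
    obtain ⟨v, hv, hn⟩ := h
    exact fun hs => not_sat_common_iff.2 ⟨n, hn⟩ (hs v hv)

theorem exists_rejects (hφ : φ.Focusable) (h : ¬ M.Sat φ w) : ∃ n, M.Rejects n w (φ, .foc) := by
  obtain ⟨φ, rfl⟩ | ⟨a, φ, rfl⟩ := hφ
  · exact not_sat_common_iff.1 h
  · obtain ⟨v, hv, hφ⟩ : ∃ v, M.rel a w v ∧ ¬ M.Sat (.common φ) v := by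
      simpa only [Sat, not_forall, exists_prop] using h
    obtain ⟨n, hn⟩ := not_sat_common_iff.1 hφ
    exact ⟨n, v, hv, hn⟩

theorem Rejects.exists_of_know {b : Ann} (h : M.Rejects n w (.know a φ, b)) :
    ∃ v, M.rel a w v ∧ M.Rejects n v (φ, b) := by
  match φ, b with
  | _, .unfoc => simpa only [Rejects, Sat, not_forall, exists_prop] using h
  | .common _, .foc => exact h

theorem Rejects.know_of_rel {b : Ann} (hvw : M.rel a v w) (h : M.Rejects n v (.know a φ, b)) :
    M.Rejects n w (.know a φ, b) := by
  match φ, b with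
  | _, .unfoc => exact fun hs => h ((sat_know_iff_of_rel hvw).2 hs)
  | .common φ, .foc =>
    obtain ⟨u, hu, hn⟩ := h
    exact ⟨u, (M.equivalence a).trans ((M.equivalence a).symm hvw) hu, hn⟩

theorem Rejects.of_unfoc {n : ℕ} {x : AFormula A At} (hx : x.2 ≠ .foc) (h : M.Rejects m w x) :
    M.Rejects n w x := by
  match x with
  | (_, .unfoc) => exact h

section Rules

variable {Γ Δ Ξ Θ : Finset (AFormula A At)} {b : Ann}

open scoped Classical in
theorem Refutes.impR [Nonempty A] (h : M.Refutes n w ⟨Γ, insert (.imp φ ψ, .unfoc) Δ⟩) :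
    ∃ v, M.Refutes n v ⟨insert (φ, .unfoc) Γ, {(ψ, .unfoc)}⟩ := by
  obtain ⟨v, hv, hφ, hψ⟩ : ∃ v, w ≤ v ∧ M.Sat φ v ∧ ¬ M.Sat ψ v := by
    simpa only [Rejects, Sat, not_forall, exists_prop] using h.2 _ (Finset.mem_insert_self _ _)
  refine ⟨v, Finset.forall_mem_insert _ _ _ |>.2 ⟨hφ, fun x hx => (h.1 x hx).mono hv⟩, ?_⟩
  simpa only [Finset.mem_singleton, forall_eq, Rejects] using hψ

open scoped Classical in
theorem Refutes.focus (hφ : φ.Focusable) (hunique : ∀ χ, (χ, Ann.foc) ∈ Δ → χ = φ)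
    (h : M.Refutes n w ⟨Γ, insert (φ, .unfoc) Δ⟩) :
    ∃ m, M.Refutes m w ⟨Γ, insert (φ, .foc) Δ⟩ ∧ ((∃ χ, (χ, Ann.foc) ∈ Δ) → m ≤ n) := by
  simp only [Refutes, Finset.forall_mem_insert] at h ⊢
  obtain ⟨hΓ, hsat, hΔ⟩ := h
  by_cases hfocus : ∃ χ, (χ, Ann.foc) ∈ Δ
  · obtain ⟨χ, hχ⟩ := hfocus
    obtain rfl := hunique χ hχ
    exact ⟨n, ⟨hΓ, hΔ _ hχ, hΔ⟩, fun _ => le_rfl⟩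
  · obtain ⟨m, hm⟩ := exists_rejects hφ hsat
    refine ⟨m, ⟨hΓ, hm, fun x hx => (hΔ x hx).of_unfoc ?_⟩, fun h => absurd h hfocus⟩
    rintro h
    exact hfocus ⟨x.1, by rwa [← h]⟩

open scoped Classical in
theorem Refutes.ruleS5
    (h : M.Refutes n w ⟨Ξ ∪ knowSet a Γ, insert (.know a φ, b) (knowSet a Δ ∪ Θ)⟩) :
    ∃ v, M.Refutes n v ⟨knowSet a Γ, insert (φ, b) (knowSet a Δ)⟩ := by
  simp only [Refutes, knowSet, Finset.forall_mem_insert, Finset.forall_mem_union,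
    Finset.forall_mem_image] at h ⊢
  obtain ⟨⟨-, hΓ⟩, hφ, hΔ, -⟩ := h
  obtain ⟨v, hv, hφ⟩ := hφ.exists_of_know
  exact ⟨v, fun _ hx => (sat_know_iff_of_rel hv).1 (hΓ hx), hφ, fun _ hx => (hΔ hx).know_of_rel hv⟩

open scoped Classical in
theorem Refutes.commonR_unfoc [Fintype A] (h : M.Refutes n w ⟨Γ, insert (.common φ, .unfoc) Δ⟩) :
    ∃ τ ∈ commonRPremises Γ Δ φ .unfoc, M.Refutes n w τ := by
  rw [exists_mem_commonRPremises]
  simp only [Refutes, Finset.forall_mem_insert, Rejects, sat_common_iff] at h ⊢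
  grind

open scoped Classical in
theorem Refutes.commonR_foc [Fintype A] (hΔ : ∀ χ, (χ, Ann.foc) ∉ Δ)
    (h : M.Refutes n w ⟨Γ, insert (.common φ, .foc) Δ⟩) :
    ∃ τ ∈ commonRPremises Γ Δ φ .foc, ∃ m, M.Refutes m w τ ∧
      ((∃ χ, (χ, Ann.foc) ∈ τ.right) → m < n) := by
  rw [exists_mem_commonRPremises]
  simp only [Refutes, Finset.forall_mem_insert] at h ⊢
  obtain ⟨hΓ, hφ, hcontext⟩ := h
  have hcontext' (m : ℕ) : ∀ x ∈ Δ, M.Rejects m w x := fun x hx =>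
    (hcontext x hx).of_unfoc fun hfoc => hΔ x.1 (by rwa [← hfoc])
  cases n with
  | zero =>
    refine .inl ⟨0, ⟨hΓ, hφ, hcontext' 0⟩, ?_⟩
    simp [hΔ]
  | succ n =>
    obtain ⟨v, ⟨a, hv⟩, hn⟩ := hφ
    exact .inr ⟨a, n, ⟨hΓ, ⟨v, hv, hn⟩, hcontext' n⟩, fun _ => n.lt_succ_self⟩

open scoped Classical in
theorem forall_notMem_of_commonR_foc [Fintype A] [Nonempty A] (σ : Sequent A At)
    (hσ : σ.toPreSequent = ⟨Γ, insert (.common φ, .foc) Δ⟩)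
    (hpremises : ∀ s ∈ commonRPremises Γ Δ φ .foc, ∃ τ : Sequent A At, τ.toPreSequent = s) :
    ∀ χ, (χ, Ann.foc) ∉ Δ := by
  intro χ hχ
  obtain rfl : χ = .common φ := σ.focus_unique _ _ (by simp [hσ, hχ]) (by simp [hσ])
  obtain ⟨τ, hτ⟩ := hpremises ⟨Γ, insert (.know (Classical.arbitrary A) (.common φ), .foc) Δ⟩
    (by simp [commonRPremises])
  cases τ.focus_unique (.common φ) (.know (Classical.arbitrary A) (.common φ)) (by simp [hτ, hχ])
    (by simp [hτ])

open scoped Classical in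
theorem Refutes.exists_premise [Fintype A] [Nonempty A] {r : RuleName A} {s : PreSequent A At}
    {l : List (PreSequent A At)} (hr : Rule r s l) (hP : Calculus.cICKS5.HasRule r)
    (hl : ∀ τ ∈ l, ∃ τ' : Sequent A At, τ'.toPreSequent = τ)
    (hcommonR : ∀ Γ Δ φ, r = .commonR → s = ⟨Γ, insert (.common φ, .foc) Δ⟩ →
      l ≠ commonRPremises Γ Δ φ .foc)
    (h : M.Refutes n w s) :
    ∃ τ ∈ l, ∃ m v, M.Refutes m v τ ∧ ((∃ χ, (χ, Ann.foc) ∈ s.right) → m ≤ n) := by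
  suffices (∃ τ ∈ l, ∃ v, M.Refutes n v τ) ∨ r = .focus by
    obtain ⟨τ, hτ, v, hv⟩ | rfl := this
    · exact ⟨τ, hτ, n, v, hv, fun _ => le_rfl⟩
    obtain - | - | - | - | - | - | - | - | - | ⟨Γ, Δ, φ⟩ := hr
    obtain ⟨τ, hτ⟩ := hl _ List.mem_cons_self
    obtain ⟨m, hm, hmn⟩ := h.focus (τ.focusable φ (by simp [hτ])) fun χ hχ =>
      τ.focus_unique χ φ (by simp [hτ, hχ]) (by simp [hτ])
    exact ⟨_, List.mem_cons_self, m, w, hm, by simpa using hmn⟩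
  cases hr with
  | ax =>
    exact absurd (h.1 _ (Finset.mem_insert_self _ _)) (h.2 _ (Finset.mem_insert_self _ _)).not_sat
  | bot => exact (h.1 _ (Finset.mem_insert_self _ _)).elim
  | ruleK | ruleS4 => exact hP.elim
  | focus => exact .inr rfl
  | impR => exact .inl ⟨_, List.mem_cons_self, h.impR⟩
  | ruleS5 => exact .inl ⟨_, List.mem_cons_self, h.ruleS5⟩
  | commonR Γ Δ φ b =>
    cases b with
    | foc => exact absurd rfl (hcommonR Γ Δ φ rfl rfl)
    | unfoc =>
      obtain ⟨τ, hτ, hw⟩ := h.commonR_unfoc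
      exact .inl ⟨τ, hτ, w, hw⟩
  | unfocus =>
    refine .inl ⟨_, List.mem_cons_self, w, h.1, ?_⟩
    have := h.2
    simp only [Finset.forall_mem_insert] at this ⊢
    exact ⟨this.1.not_sat, this.2⟩
  | _ =>
    suffices ∃ τ ∈ _, M.Refutes n w τ from .inl (this.imp fun τ hτ => ⟨hτ.1, w, hτ.2⟩)
    have := fun φ ψ => sat_of_sat_imp (M := M) (φ := φ) (ψ := ψ) (w := w)
    have := fun φ a => sat_of_sat_know (M := M) (a := a) (φ := φ) (w := w)
    simp only [Refutes, Rejects, Sat.eq_3, Sat.eq_4, sat_know_imp_iff, sat_common_iff,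
      Finset.forall_mem_insert, Finset.forall_mem_union, Finset.forall_mem_image,
      Finset.mem_univ, forall_true_left,
      List.mem_cons, List.not_mem_nil, or_false, exists_eq_or_imp, exists_eq_left] at *
    grind

end Rules

theorem transmitsRefutations [Fintype A] [Nonempty A] (M : Model A At W) :
    ProofTree.TransmitsRefutations (fun i : RuleTriple A At => i.IsInstance .cICKS5)
      fun n σ => ∃ w, M.Refutes n w σ.toPreSequent := by
  rintro i ⟨hP, hr⟩ n ⟨w, hw⟩
  have hl : ∀ s ∈ i.premises.map Sequent.toPreSequent, ∃ τ ∈ i.premises, τ.toPreSequent = s :=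
    fun s hs => List.mem_map.1 hs
  by_cases hi : i.IsFocusedCommonR
  · obtain ⟨-, Γ, Δ, φ, hσ, hpremises⟩ := id hi
    have hΔ := forall_notMem_of_commonR_foc i.conclusion hσ fun s hs => by
      obtain ⟨τ, -, hτ⟩ := hl s (by rwa [hpremises])
      exact ⟨τ, hτ⟩
    rw [hσ] at hw
    obtain ⟨s, hs, m, hm, hmn⟩ := hw.commonR_foc hΔ
    obtain ⟨τ, hτ, rfl⟩ := hl s (by rwa [hpremises])
    exact ⟨τ, hτ, m, ⟨w, hm⟩, fun _ hfocus => ⟨(hmn hfocus).le, fun _ => hmn hfocus⟩⟩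
  · obtain ⟨s, hs, m, v, hv, hmn⟩ := hw.exists_premise hr hP
      (fun s hs => (hl s hs).imp fun _ => And.right) fun Γ Δ φ hrule hσ hpremises =>
        hi ⟨hrule, Γ, Δ, φ, hσ, hpremises⟩
    obtain ⟨τ, hτ, rfl⟩ := hl s hs
    exact ⟨τ, hτ, m, ⟨v, hv⟩, fun hfocus _ => ⟨hmn hfocus, fun h => absurd h hi⟩⟩

theorem exists_refutes {σ : Sequent A At} (hleft : ∀ x ∈ σ.left, M.Sat x.1 w)
    (hright : ∀ x ∈ σ.right, ¬ M.Sat x.1 w) : ∃ n, M.Refutes n w σ.toPreSequent := by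
  by_cases hσ : σ.HasFocus
  · obtain ⟨χ, hχ⟩ := hσ
    obtain ⟨n, hn⟩ := exists_rejects (σ.focusable χ hχ) (hright _ hχ)
    refine ⟨n, hleft, ?_⟩
    rintro ⟨φ, _ | _⟩ hφ
    · exact hright _ hφ
    · rwa [σ.focus_unique φ χ hφ hχ]
  · refine ⟨0, hleft, ?_⟩
    rintro ⟨φ, _ | _⟩ hφ
    · exact hright _ hφ
    · exact absurd ⟨φ, hφ⟩ hσ

theorem exists_sat_of_provable [Fintype A] [Nonempty A] {σ : Sequent A At}
    (h : Provable .cICKS5 σ) (hleft : ∀ x ∈ σ.left, M.Sat x.1 w) :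
    ∃ x ∈ σ.right, M.Sat x.1 w := by
  by_contra! hright
  obtain ⟨n, hn⟩ := exists_refutes hleft hright
  obtain ⟨π, hπ⟩ := h
  have hcorrect := hπ.correct (Q := fun i => i.IsInstance .cICKS5)
    fun p i child hp => (hπ.preProof p i child hp).1
  rw [← hπ.root] at hn
  exact hcorrect.not_refuted M.transmitsRefutations ⟨w, hn⟩

end Model

/-! ### Rules as closure properties of the winning region -/

section Holds

variable {A At : Type*} {S : Finset (Formula A At)} {X Y Z : Set (SequentOver S)}
  {s : PreSequent A At}

theorem Sequent.toPreSequent_injective :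
    Function.Injective (Sequent.toPreSequent : Sequent A At → PreSequent A At) :=
  fun _ _ h => Sequent.ext (congrArg PreSequent.left h) (congrArg PreSequent.right h)

/-- The pair is an `S`-sequent that belongs to `X`. -/
def Holds (X : Set (SequentOver S)) (s : PreSequent A At) : Prop :=
  ∃ τ ∈ X, τ.1.toPreSequent = s

theorem holds_iff_mem {τ : SequentOver S} : Holds X τ.1.toPreSequent ↔ τ ∈ X := by
  refine ⟨?_, fun h => ⟨τ, h, rfl⟩⟩
  rintro ⟨τ', hτ', h⟩
  rwa [← Subtype.ext (Sequent.toPreSequent_injective h)]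

theorem Holds.mono (hs : Holds X s) (h : X ⊆ Y) : Holds Y s :=
  hs.imp fun _ hτ => ⟨h hτ.1, hτ.2⟩

variable [Fintype A] {P : Calculus} {r : RuleName A} {l : List (PreSequent A At)}

theorem Rule.exists_rulePosition {τ : SequentOver S} (hr : Rule r τ.1.toPreSequent l)
    (hP : P.HasRule r) (hl : ∀ s ∈ l, Holds X s) :
    ∃ i : RulePosition P S, i.1.conclusion = τ.1 ∧ i.1.rule = r ∧
      i.1.premises.map Sequent.toPreSequent = l ∧
      ∀ τ' : SequentOver S, τ'.1 ∈ i.1.premises → τ' ∈ X := by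
  obtain ⟨l', rfl⟩ : ∃ l' : List X, l'.map (fun τ => τ.1.1.toPreSequent) = l := by
    clear hr
    induction l with
    | nil => exact ⟨[], rfl⟩
    | cons s l ih =>
      obtain ⟨⟨τ, hτ, rfl⟩, hl'⟩ := List.forall_mem_cons.1 hl
      obtain ⟨l', rfl⟩ := ih hl'
      exact ⟨⟨τ, hτ⟩ :: l', rfl⟩
  have hmap : (l'.map fun τ => τ.1.1).map Sequent.toPreSequent =
      l'.map fun τ => τ.1.1.toPreSequent := List.map_map
  refine ⟨⟨⟨τ.1, r, l'.map fun τ => τ.1.1⟩, ⟨hP, by rwa [hmap]⟩, τ.2, ?_⟩, rfl, rfl, hmap, ?_⟩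
  · rintro _ hτ'
    obtain ⟨τ', -, rfl⟩ := List.mem_map.1 hτ'
    exact τ'.1.2
  · intro τ' hτ'
    obtain ⟨τ'', -, h⟩ := List.mem_map.1 hτ'
    exact Subtype.ext h ▸ τ''.2

theorem Rule.holds_winSet (hr : Rule r s l) (hP : P.HasRule r)
    (hs : ∃ τ : SequentOver S, τ.1.toPreSequent = s) (hl : ∀ s ∈ l, Holds (winSet P S) s) :
    Holds (winSet P S) s := by
  obtain ⟨τ, rfl⟩ := hs
  obtain ⟨i, hi, -, -, hpremises⟩ := hr.exists_rulePosition hP hl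
  rw [holds_iff_mem, ← stepSet_winSet]
  exact ⟨i, hi, fun τ' hτ' => by simpa using hpremises τ' hτ'⟩

theorem Rule.holds_reachSet (hr : Rule r s l) (hP : P.HasRule r) (hne : r ≠ .commonR)
    (hs : ∃ τ : SequentOver S, τ.1.toPreSequent = s) (hfocus : ∃ φ, (φ, Ann.foc) ∈ s.right)
    (hl : ∀ s ∈ l, Holds (reachSet P S Y Z) s) : Holds (reachSet P S Y Z) s := by
  obtain ⟨τ, rfl⟩ := hs
  obtain ⟨i, hi, rfl, -, hpremises⟩ := hr.exists_rulePosition hP hl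
  rw [holds_iff_mem, ← stepSet_reachSet]
  refine ⟨i, hi, fun τ' hτ' => ?_⟩
  rw [RuleTriple.target_of_hasFocus (fun hcommon => hne hcommon.1) (by rwa [hi])]
  exact hpremises τ' hτ'

open scoped Classical in
theorem holds_reachSet_of_commonR {Γ Δ : Finset (AFormula A At)} {φ : Formula A At}
    (hP : P.HasRule (.commonR : RuleName A))
    (hs : ∃ τ : SequentOver S, τ.1.toPreSequent = ⟨Γ, insert (.common φ, .foc) Δ⟩)
    (hl : ∀ s ∈ commonRPremises Γ Δ φ .foc, Holds Y s) :
    Holds (reachSet P S Y Z) ⟨Γ, insert (.common φ, .foc) Δ⟩ := by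
  have hr := Rule.commonR Γ Δ φ .foc
  obtain ⟨τ, hτ⟩ := hs
  rw [← hτ] at hr ⊢
  obtain ⟨i, hi, hrule, hmap, hpremises⟩ := hr.exists_rulePosition hP hl
  rw [holds_iff_mem, ← stepSet_reachSet]
  refine ⟨i, hi, fun τ' hτ' => ?_⟩
  rw [RuleTriple.target_of_isFocusedCommonR ⟨hrule, Γ, Δ, φ, by rw [hi, hτ], hmap⟩]
  exact hpremises τ' hτ'

end Holds

section PlainSequents

variable {A At : Type*} {S Γ Δ : Finset (Formula A At)} {φ χ : Formula A At}

open scoped Classical in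
/-- The formulae of a finite set, unfocused. -/
noncomputable def unfocused (Γ : Finset (Formula A At)) : Finset (AFormula A At) :=
  Γ.image fun φ => (φ, .unfoc)

@[simp] theorem mem_unfocused {b : Ann} : (φ, b) ∈ unfocused Γ ↔ φ ∈ Γ ∧ b = .unfoc := by
  simp [unfocused, eq_comm]

open scoped Classical in
theorem unfocused_insert : unfocused (insert φ Γ) = insert (φ, .unfoc) (unfocused Γ) :=
  Finset.image_insert _ _ _

theorem unfocused_singleton : unfocused {φ} = {(φ, .unfoc)} := by
  classical exact Finset.image_singleton _ _

open scoped Classical in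
theorem unfocused_union : unfocused (Γ ∪ Δ) = unfocused Γ ∪ unfocused Δ :=
  Finset.image_union _ _

/-- The sequent `Γ ⇒ Δ` without focus. -/
noncomputable abbrev plain (Γ Δ : Finset (Formula A At)) : PreSequent A At :=
  ⟨unfocused Γ, unfocused Δ⟩

open scoped Classical in
/-- The sequent `Γ ⇒ χ, Δ` with `χ` in focus. -/
noncomputable abbrev focusedOn (χ : Formula A At) (Γ Δ : Finset (Formula A At)) :
    PreSequent A At :=
  ⟨unfocused Γ, insert (χ, .foc) (unfocused Δ)⟩

theorem exists_eq_plain (hΓ : Γ ⊆ S) (hΔ : Δ ⊆ S) :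
    ∃ τ : SequentOver S, τ.1.toPreSequent = plain Γ Δ := by
  refine ⟨⟨⟨plain Γ Δ, by simp, by simp, by simp⟩, ?_⟩, rfl⟩
  rintro φ b (h | h)
  · exact hΓ (mem_unfocused.1 h).1
  · exact hΔ (mem_unfocused.1 h).1

theorem exists_eq_focusedOn (hχ : χ.Focusable) (hχS : χ ∈ S) (hΓ : Γ ⊆ S) (hΔ : Δ ⊆ S) :
    ∃ τ : SequentOver S, τ.1.toPreSequent = focusedOn χ Γ Δ := by
  refine ⟨⟨⟨focusedOn χ Γ Δ, by simp, by simp +contextual, by simp [hχ]⟩, ?_⟩, rfl⟩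
  rintro φ b (h | h)
  · exact hΓ (mem_unfocused.1 h).1
  · classical
    obtain ⟨⟨⟩⟩ | h := Finset.mem_insert.1 h
    · exact hχS
    · exact hΔ (mem_unfocused.1 h).1

end PlainSequents

theorem cut_induction {α : Type*} [DecidableEq α] {S Γ Δ : Finset α}
    {Q : Finset α → Finset α → Prop}
    (hcut : ∀ Γ Δ, Γ ⊆ S → Δ ⊆ S → ∀ x ∈ S, Q (insert x Γ) Δ → Q Γ (insert x Δ) → Q Γ Δ)
    (hΓ : Γ ⊆ S) (hΔ : Δ ⊆ S)
    (hmax : ∀ Γ' Δ', Γ ⊆ Γ' → Δ ⊆ Δ' → Γ' ∪ Δ' = S → Q Γ' Δ') : Q Γ Δ := by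
  suffices ∀ T ⊆ S, ∀ Γ' Δ', Γ ⊆ Γ' → Δ ⊆ Δ' → Γ' ⊆ S → Δ' ⊆ S → S ⊆ T ∪ (Γ' ∪ Δ') → Q Γ' Δ' from
    this S subset_rfl Γ Δ subset_rfl subset_rfl hΓ hΔ Finset.subset_union_left
  intro T
  induction T using Finset.induction_on with
  | empty =>
    intro _ Γ' Δ' hΓΓ' hΔΔ' hΓ' hΔ' hS
    exact hmax Γ' Δ' hΓΓ' hΔΔ' ((Finset.union_subset hΓ' hΔ').antisymm (by simpa using hS))
  | insert x T _ ih =>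
    intro hT Γ' Δ' hΓΓ' hΔΔ' hΓ' hΔ' hS
    obtain ⟨hx, hT⟩ := Finset.insert_subset_iff.1 hT
    apply hcut Γ' Δ' hΓ' hΔ' x hx <;> apply ih hT <;> grind

/-! ### The canonical model -/

section Derivable

variable {A At : Type*} [Fintype A] {S Γ Δ : Finset (Formula A At)} {φ : Formula A At}

variable (S) in
/-- Prover wins from the given `S`-sequent in `cICKS5`. -/
abbrev Derivable (s : PreSequent A At) : Prop :=
  Holds (winSet .cICKS5 S) s

theorem derivable_plain_of_mem (hΓ : Γ ⊆ S) (hΔ : Δ ⊆ S) (hφΓ : φ ∈ Γ) (hφΔ : φ ∈ Δ) :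
    Derivable S (plain Γ Δ) := by
  classical
  have hr := Rule.ax (unfocused Γ) (unfocused Δ) φ .unfoc
  rw [Finset.insert_eq_of_mem (by simpa), Finset.insert_eq_of_mem (by simpa)] at hr
  exact hr.holds_winSet trivial (exists_eq_plain hΓ hΔ) (by simp)

theorem disjoint_of_not_derivable_plain (hΓ : Γ ⊆ S) (hΔ : Δ ⊆ S)
    (h : ¬ Derivable S (plain Γ Δ)) : Disjoint Γ Δ :=
  Finset.disjoint_left.2 fun _ hφΓ hφΔ => h (derivable_plain_of_mem hΓ hΔ hφΓ hφΔ)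

end Derivable

open scoped Classical in
/-- The worlds of the canonical model: the subsets `Γ` of `S` for which `Γ ⇒ S \ Γ` is not
derivable. -/
structure World {A At : Type*} [Fintype A] (S : Finset (Formula A At)) where
  carrier : Finset (Formula A At)
  subset : carrier ⊆ S
  not_derivable : ¬ Derivable S (plain carrier (S \ carrier))

open scoped Classical in
theorem exists_world_of_union_eq {A At : Type*} [Fintype A] {S Γ Δ : Finset (Formula A At)}
    (hS : Γ ∪ Δ = S) (h : ¬ Derivable S (plain Γ Δ)) :
    ∃ w : World S, w.carrier = Γ ∧ S \ w.carrier = Δ := by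
  have hΓ : Γ ⊆ S := hS ▸ Finset.subset_union_left
  have hΔ : Δ ⊆ S := hS ▸ Finset.subset_union_right
  have hdiff : S \ Γ = Δ := by
    rw [← hS]
    exact Finset.union_sdiff_cancel_left (disjoint_of_not_derivable_plain hΓ hΔ h)
  exact ⟨⟨Γ, hΓ, by rwa [hdiff]⟩, rfl, hdiff⟩

theorem exists_world {A At : Type*} [Fintype A] {S Γ Δ : Finset (Formula A At)}
    (hΓ : Γ ⊆ S) (hΔ : Δ ⊆ S) (h : ¬ Derivable S (plain Γ Δ)) :
    ∃ w : World S, Γ ⊆ w.carrier ∧ Disjoint w.carrier Δ := by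
  classical
  by_contra! hno
  refine h (cut_induction (Q := fun Γ Δ => Derivable S (plain Γ Δ)) ?_ hΓ hΔ ?_)
  · intro Γ Δ hΓ hΔ φ _ hl hr
    refine (Rule.cut _ _ φ).holds_winSet trivial (exists_eq_plain hΓ hΔ) ?_
    simpa only [List.forall_mem_cons, List.not_mem_nil, false_imp_iff, implies_true, and_true,
      ← unfocused_insert] using ⟨hl, hr⟩
  · intro Γ' Δ' hΓ' hΔ' hS
    by_contra hnot
    obtain ⟨w, rfl, rfl⟩ := exists_world_of_union_eq hS hnot
    exact hno w hΓ' (Finset.disjoint_sdiff.mono_right hΔ')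

namespace World

variable {A At : Type*} [Fintype A] {S Γ Δ : Finset (Formula A At)} {φ ψ χ : Formula A At} {a : A}

instance : Preorder (World S) := Preorder.lift carrier

variable (w : World S)

open scoped Classical in
theorem subset_of_not_derivable (hΓ : Γ ⊆ S) (h : ¬ Derivable S (plain Γ (S \ w.carrier))) :
    Γ ⊆ w.carrier := fun φ hφ => by
  by_contra hw
  exact h (derivable_plain_of_mem hΓ Finset.sdiff_subset hφ (Finset.mem_sdiff.2 ⟨hΓ hφ, hw⟩))

theorem disjoint_of_not_derivable (hΔ : Δ ⊆ S) (h : ¬ Derivable S (plain w.carrier Δ)) :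
    Disjoint w.carrier Δ :=
  disjoint_of_not_derivable_plain w.subset hΔ h

section Rules

variable {r : RuleName A} {l : List (PreSequent A At)}

open scoped Classical in
theorem exists_not_derivable_of_mem (hχ : χ ∈ w.carrier)
    (hr : Rule r ⟨insert (χ, .unfoc) (unfocused w.carrier), unfocused (S \ w.carrier)⟩ l)
    (hP : Calculus.cICKS5.HasRule r) : ∃ s ∈ l, ¬ Derivable S s := by
  rw [Finset.insert_eq_of_mem (by simpa)] at hr
  by_contra! hl
  exact w.not_derivable (hr.holds_winSet hP (exists_eq_plain w.subset Finset.sdiff_subset) hl)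

open scoped Classical in
theorem exists_not_derivable_of_notMem (hχS : χ ∈ S) (hχ : χ ∉ w.carrier)
    (hr : Rule r ⟨unfocused w.carrier, insert (χ, .unfoc) (unfocused (S \ w.carrier))⟩ l)
    (hP : Calculus.cICKS5.HasRule r) : ∃ s ∈ l, ¬ Derivable S s := by
  rw [Finset.insert_eq_of_mem (by simp [hχ, hχS])] at hr
  by_contra! hl
  exact w.not_derivable (hr.holds_winSet hP (exists_eq_plain w.subset Finset.sdiff_subset) hl)

end Rules

theorem bot_notMem : Formula.bot ∉ w.carrier := by
  classical
  intro h
  simpa using w.exists_not_derivable_of_mem h (Rule.bot _ _) trivial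

theorem and_mem_iff (hS : IsClosedSet (S : Set (Formula A At))) (h : Formula.and φ ψ ∈ S) :
    Formula.and φ ψ ∈ w.carrier ↔ φ ∈ w.carrier ∧ ψ ∈ w.carrier := by
  classical
  obtain ⟨hφ, hψ⟩ := hS.and_mem _ _ h
  constructor
  · intro hw
    have hpremise := w.exists_not_derivable_of_mem hw (Rule.andL _ _ φ ψ) trivial
    simp only [← unfocused_insert, List.mem_singleton, exists_eq_left] at hpremise
    have hsubset := w.subset_of_not_derivable (by grind [w.subset]) hpremise
    grind
  · rintro ⟨hφw, hψw⟩
    by_contra hw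
    have hpremises := w.exists_not_derivable_of_notMem h hw (Rule.andR _ _ φ ψ) trivial
    simp only [← unfocused_insert, List.mem_cons, List.not_mem_nil, or_false, exists_eq_or_imp,
      exists_eq_left] at hpremises
    obtain hpremise | hpremise := hpremises
    all_goals
      have hdisjoint := w.disjoint_of_not_derivable (by grind) hpremise
      grind

theorem or_mem_iff (hS : IsClosedSet (S : Set (Formula A At))) (h : Formula.or φ ψ ∈ S) :
    Formula.or φ ψ ∈ w.carrier ↔ φ ∈ w.carrier ∨ ψ ∈ w.carrier := by
  classical
  obtain ⟨hφ, hψ⟩ := hS.or_mem _ _ h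
  constructor
  · intro hw
    have hpremises := w.exists_not_derivable_of_mem hw (Rule.orL _ _ φ ψ) trivial
    simp only [← unfocused_insert, List.mem_cons, List.not_mem_nil, or_false, exists_eq_or_imp,
      exists_eq_left] at hpremises
    obtain hpremise | hpremise := hpremises
    all_goals
      have hsubset := w.subset_of_not_derivable (by grind [w.subset]) hpremise
      grind
  · contrapose
    intro hw
    have hpremise := w.exists_not_derivable_of_notMem h hw (Rule.orR _ _ φ ψ) trivial
    simp only [← unfocused_insert, List.mem_singleton, exists_eq_left] at hpremise
    have hdisjoint := w.disjoint_of_not_derivable (by grind) hpremise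
    grind

theorem mem_of_imp_mem (hS : IsClosedSet (S : Set (Formula A At)))
    (h : Formula.imp φ ψ ∈ w.carrier) (hφw : φ ∈ w.carrier) : ψ ∈ w.carrier := by
  classical
  obtain ⟨hφ, hψ⟩ := hS.imp_mem _ _ (w.subset h)
  have hpremises := w.exists_not_derivable_of_mem h (Rule.impL _ _ φ ψ) trivial
  simp only [← unfocused_insert, List.mem_cons, List.not_mem_nil, or_false, exists_eq_or_imp,
    exists_eq_left] at hpremises
  obtain hpremise | hpremise := hpremises
  · have hdisjoint := w.disjoint_of_not_derivable (by grind) hpremise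
    grind
  · have hsubset := w.subset_of_not_derivable (by grind [w.subset]) hpremise
    grind

theorem imp_mem_iff (hS : IsClosedSet (S : Set (Formula A At))) (h : Formula.imp φ ψ ∈ S) :
    Formula.imp φ ψ ∈ w.carrier ↔ ∀ v ≥ w, φ ∈ v.carrier → ψ ∈ v.carrier := by
  classical
  refine ⟨fun hw v hv => v.mem_of_imp_mem hS (hv hw), fun hall => ?_⟩
  obtain ⟨hφ, hψ⟩ := hS.imp_mem _ _ h
  by_contra hw
  have hpremise := w.exists_not_derivable_of_notMem h hw (Rule.impR _ _ φ ψ) trivial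
  simp only [← unfocused_insert, ← unfocused_singleton, List.mem_singleton, exists_eq_left]
    at hpremise
  obtain ⟨v, hv, hψv⟩ := exists_world (by grind [w.subset]) (by simpa using hψ) hpremise
  obtain ⟨hφv, hwv⟩ := Finset.insert_subset_iff.1 hv
  exact Finset.disjoint_singleton_right.1 hψv (hall v hwv hφv)

theorem know_mem_of_le (hS : IsNegClosedSet (S : Set (Formula A At))) {v w : World S}
    (hwv : w ≤ v) (h : Formula.know a φ ∈ v.carrier) : Formula.know a φ ∈ w.carrier := by
  classical
  by_contra hw
  have hneg := hS.neg_know_mem a φ (v.subset h)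
  have hnegw : (Formula.know a φ).neg ∈ w.carrier := by
    by_contra hnegw
    have hpremise := w.exists_not_derivable_of_notMem hneg hnegw (Rule.knowImp a _ _ φ .bot) trivial
    simp only [← unfocused_insert, List.mem_singleton, exists_eq_left] at hpremise
    have hbot := (hS.imp_mem _ _ hneg).2
    have hdisjoint := disjoint_of_not_derivable_plain (by grind [w.subset, v.subset]) (by grind)
      hpremise
    grind [v.subset]
  exact v.bot_notMem (v.mem_of_imp_mem hS.toIsClosedSet (hwv hnegw) h)

theorem mem_of_know_mem (hS : IsClosedSet (S : Set (Formula A At)))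
    (h : Formula.know a φ ∈ w.carrier) : φ ∈ w.carrier := by
  classical
  have hφ := hS.know_mem _ _ (w.subset h)
  have hpremise := w.exists_not_derivable_of_mem h (Rule.ruleT a _ _ φ) trivial
  simp only [← unfocused_insert, List.mem_singleton, exists_eq_left] at hpremise
  have hsubset := w.subset_of_not_derivable (by grind [w.subset]) hpremise
  grind

theorem mem_of_common_mem (hS : IsClosedSet (S : Set (Formula A At)))
    (h : Formula.common φ ∈ w.carrier) :
    φ ∈ w.carrier ∧ ∀ a, Formula.know a (.common φ) ∈ w.carrier := by
  classical
  obtain ⟨hφ, hknow⟩ := hS.common_mem _ (w.subset h)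
  have hpremise := w.exists_not_derivable_of_mem h (Rule.commonL _ _ φ) trivial
  have hunfocused : (Finset.univ.image fun a : A => (Formula.know a (.common φ), Ann.unfoc)) =
      unfocused (Finset.univ.image fun a : A => Formula.know a (.common φ)) := by
    simp only [unfocused, Finset.image_image, Function.comp_def]
  simp only [hunfocused, ← unfocused_union, ← unfocused_insert, List.mem_singleton,
    exists_eq_left] at hpremise
  have hsubset := w.subset_of_not_derivable (by grind [w.subset]) hpremise
  grind

end World

section KnowPart

variable {A At : Type*} (a : A) (Γ Δ : Finset (Formula A At)) (φ : Formula A At)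

open scoped Classical in
/-- The formulae of the form `K_a φ` in `Γ`. -/
noncomputable def knowPart : Finset (Formula A At) :=
  {χ ∈ Γ | χ ∈ Set.range (Formula.know a)}

theorem knowPart_subset : knowPart a Γ ⊆ Γ := by
  classical exact Finset.filter_subset _ _

theorem know_mem_knowPart_iff : Formula.know a φ ∈ knowPart a Γ ↔ Formula.know a φ ∈ Γ := by
  simp [knowPart]

open scoped Classical in
theorem exists_knowSet_eq :
    ∃ Γ' : Finset (AFormula A At), knowSet a Γ' = unfocused (knowPart a Γ) := by
  have hinj : Function.Injective (Formula.know a : Formula A At → Formula A At) :=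
    fun _ _ h => by cases h; rfl
  refine ⟨unfocused (Γ.preimage (Formula.know a) hinj.injOn), ?_⟩
  rw [knowPart, ← Finset.image_preimage _ _ hinj.injOn]
  simp only [knowSet, unfocused, Finset.image_image, Function.comp_def]

open scoped Classical in
theorem rule_ruleS5_knowPart [Fintype A] (b : Ann) :
    Rule (.ruleS5 a) ⟨unfocused Γ, insert (.know a φ, b) (unfocused Δ)⟩
      [⟨unfocused (knowPart a Γ), insert (φ, b) (unfocused (knowPart a Δ))⟩] := by
  obtain ⟨Γ', hΓ⟩ := exists_knowSet_eq a Γ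
  obtain ⟨Δ', hΔ⟩ := exists_knowSet_eq a Δ
  have hr := Rule.ruleS5 a Γ' Δ' (unfocused Γ) (unfocused Δ) φ b
  rwa [hΓ, hΔ, ← unfocused_union, ← unfocused_union,
    Finset.union_eq_left.2 (knowPart_subset a Γ), Finset.union_eq_right.2 (knowPart_subset a Δ)]
    at hr

end KnowPart

namespace World

variable {A At : Type*} [Fintype A] {S Γ Δ : Finset (Formula A At)} {φ : Formula A At} {a : A}

/-- The accessibility relation of the canonical model: the two worlds contain the same formulae
`K_a φ`. -/
def SameKnowledge (a : A) (w v : World S) : Prop :=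
  ∀ φ, Formula.know a φ ∈ w.carrier ↔ Formula.know a φ ∈ v.carrier

open scoped Classical in
theorem sameKnowledge_of_knowPart_subset {w v : World S}
    (hsubset : knowPart a w.carrier ⊆ v.carrier)
    (hdisjoint : Disjoint v.carrier (knowPart a (S \ w.carrier))) : SameKnowledge a w v := by
  refine fun φ => ⟨fun hw => hsubset ((know_mem_knowPart_iff _ _ _).2 hw), fun hv => ?_⟩
  by_contra hw
  exact Finset.disjoint_left.1 hdisjoint hv
    ((know_mem_knowPart_iff _ _ _).2 (Finset.mem_sdiff.2 ⟨v.subset hv, hw⟩))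

theorem know_mem_iff (hS : IsClosedSet (S : Set (Formula A At))) (w : World S)
    (h : Formula.know a φ ∈ S) :
    Formula.know a φ ∈ w.carrier ↔ ∀ v, SameKnowledge a w v → φ ∈ v.carrier := by
  classical
  refine ⟨fun hw v hv => v.mem_of_know_mem hS ((hv φ).1 hw), fun hall => ?_⟩
  by_contra hw
  have hpremise := w.exists_not_derivable_of_notMem h hw (rule_ruleS5_knowPart a _ _ φ .unfoc)
    trivial
  simp only [← unfocused_insert, List.mem_singleton, exists_eq_left] at hpremise
  obtain ⟨v, hsubset, hdisjoint⟩ := exists_world ((knowPart_subset a _).trans w.subset)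
    (Finset.insert_subset (hS.know_mem _ _ h) ((knowPart_subset a _).trans Finset.sdiff_subset))
    hpremise
  rw [Finset.disjoint_insert_right] at hdisjoint
  exact hdisjoint.1 (hall v (sameKnowledge_of_knowPart_subset hsubset hdisjoint.2))

section Common

variable {V : Set (World S)} (hV : ∀ v ∈ V, φ ∈ v.carrier) (h : Formula.common φ ∈ S)
  (hS : IsClosedSet (S : Set (Formula A At)))

open scoped Classical in
/-- The sequents `v ⇒ K_a C φ, S \ v` with `K_a C φ` in focus, for worlds `v` in `V`. -/
def knowCommonSequents (V : Set (World S)) (φ : Formula A At) : Set (SequentOver S) :=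
  {τ | ∃ a, ∃ v ∈ V, τ.1.toPreSequent = focusedOn (.know a (.common φ)) v.carrier (S \ v.carrier)}

include hS h in
open scoped Classical in
theorem holds_knowCommonSequents {v : World S} (hv : v ∈ V) (a : A) :
    Holds (knowCommonSequents V φ)
      (focusedOn (.know a (.common φ)) v.carrier (S \ v.carrier)) := by
  obtain ⟨τ, hτ⟩ := exists_eq_focusedOn (.inr ⟨a, φ, rfl⟩) ((hS.common_mem _ h).2 a) v.subset
    (Finset.sdiff_subset : S \ v.carrier ⊆ S)
  exact ⟨τ, ⟨a, v, hv, hτ⟩, hτ⟩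

include hS h in
open scoped Classical in
theorem derivable_insert_unfoc {v : World S} (hφ : φ ∈ v.carrier) :
    Derivable S ⟨unfocused v.carrier, insert (φ, .unfoc) (unfocused (S \ v.carrier))⟩ := by
  rw [← unfocused_insert]
  exact derivable_plain_of_mem v.subset
    (Finset.insert_subset (hS.common_mem _ h).1 Finset.sdiff_subset) hφ
    (Finset.mem_insert_self _ _)

include hV hS h in
open scoped Classical in
theorem holds_reachSet_focusedOn_common (hΓΔ : Γ ∪ Δ = S)
    (hworld : ∀ v : World S, v.carrier = Γ → S \ v.carrier = Δ → v ∈ V) :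
    Holds (reachSet .cICKS5 S (knowCommonSequents V φ ∪ winSet .cICKS5 S) (winSet .cICKS5 S))
      (focusedOn (.common φ) Γ Δ) := by
  have hseq : ∃ τ : SequentOver S, τ.1.toPreSequent = focusedOn (.common φ) Γ Δ :=
    exists_eq_focusedOn (.inl ⟨φ, rfl⟩) h (hΓΔ ▸ Finset.subset_union_left)
      (hΓΔ ▸ Finset.subset_union_right)
  by_cases hplain : Derivable S (plain Γ (insert (.common φ) Δ))
  · refine Holds.mono ?_ (winSet_subset_reachSet _ _ Set.subset_union_right)
    rw [plain, unfocused_insert] at hplain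
    exact (Rule.unfocus _ _ (.common φ)).holds_winSet trivial hseq (by simpa using hplain)
  · have hΓ : Γ ⊆ S := hΓΔ ▸ Finset.subset_union_left
    have hΔ : Δ ⊆ S := hΓΔ ▸ Finset.subset_union_right
    have hdisjoint := disjoint_of_not_derivable_plain hΓ (Finset.insert_subset h hΔ) hplain
    have hmem : Formula.common φ ∈ Δ := by grind
    rw [Finset.insert_eq_of_mem hmem] at hplain
    obtain ⟨v, rfl, rfl⟩ := exists_world_of_union_eq hΓΔ hplain
    have hv := hworld v rfl rfl
    refine holds_reachSet_of_commonR trivial hseq (forall_mem_commonRPremises.2 ⟨?_, fun a => ?_⟩)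
    · exact (derivable_insert_unfoc h hS (hV v hv)).mono Set.subset_union_right
    · exact (holds_knowCommonSequents h hS hv a).mono Set.subset_union_left

include hV hS h in
/-- Below `v ⇒ K_a C φ`, the rule `S5_a`, cuts on all formulae of `S` and a focused right unfolding
lead back to sequents of the same kind: they support each other in a cyclic proof. -/
theorem knowCommonSequents_subset_winSet
    (hclosed : ∀ v ∈ V, ∀ a u, SameKnowledge a v u → u ∈ V) :
    knowCommonSequents V φ ⊆ winSet .cICKS5 S := by
  classical
  refine subset_winSet_of_subset_reachSet .cICKS5 S ?_
  rintro τ ⟨a, v, hv, hτ⟩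
  rw [← holds_iff_mem, hτ]
  refine (rule_ruleS5_knowPart a _ _ (.common φ) .foc).holds_reachSet trivial (by simp) ⟨τ, hτ⟩
    ⟨_, Finset.mem_insert_self _ _⟩ ?_
  rw [List.forall_mem_singleton]
  refine cut_induction (Q := fun Γ Δ => Holds _ (focusedOn (.common φ) Γ Δ)) ?_
    ((knowPart_subset a _).trans v.subset) ((knowPart_subset a _).trans Finset.sdiff_subset) ?_
  · intro Γ Δ hΓ hΔ ψ _ hl hr
    refine (Rule.cut _ _ ψ).holds_reachSet trivial (by simp)
      (exists_eq_focusedOn (.inl ⟨φ, rfl⟩) h hΓ hΔ) ⟨_, Finset.mem_insert_self _ _⟩ ?_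
    rw [focusedOn, unfocused_insert] at hl hr
    rw [Finset.insert_comm] at hr
    simpa only [List.forall_mem_cons, List.not_mem_nil, false_imp_iff, implies_true, and_true]
      using ⟨hl, hr⟩
  · rintro Γ Δ hΓ hΔ hΓΔ
    refine holds_reachSet_focusedOn_common hV h hS hΓΔ ?_
    rintro u rfl rfl
    exact hclosed v hv a u
      (sameKnowledge_of_knowPart_subset hΓ (Finset.disjoint_sdiff.mono_right hΔ))

include hV hS h in
theorem common_mem_of_forall_mem (hclosed : ∀ v ∈ V, ∀ a u, SameKnowledge a v u → u ∈ V)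
    {w : World S} (hw : w ∈ V) : Formula.common φ ∈ w.carrier := by
  classical
  by_contra hnot
  obtain ⟨s, hs, hsnot⟩ := w.exists_not_derivable_of_notMem h hnot (Rule.commonR _ _ φ .unfoc)
    trivial
  refine hsnot (forall_mem_commonRPremises.2 ⟨?_, fun a => ?_⟩ s hs)
  · exact derivable_insert_unfoc h hS (hV w hw)
  · obtain ⟨τ, hτ⟩ := exists_eq_plain w.subset
      (Finset.insert_subset ((hS.common_mem _ h).2 a) Finset.sdiff_subset)
    rw [plain, unfocused_insert] at hτ
    refine (Rule.focus _ _ _).holds_winSet trivial ⟨τ, hτ⟩ ?_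
    rw [List.forall_mem_singleton]
    exact (holds_knowCommonSequents h hS hw a).mono
      (knowCommonSequents_subset_winSet hV h hS hclosed)

end Common

section CanonicalModel

variable (hS : IsNegClosedSet (S : Set (Formula A At)))

/-- The canonical model: worlds are ordered by inclusion, and atoms hold where they belong. -/
def canonicalModel : Model A At (World S) where
  rel := SameKnowledge
  val p w := Formula.atom p ∈ w.carrier
  equivalence _ := ⟨fun _ _ => .rfl, fun h φ => (h φ).symm, fun h h' φ => (h φ).trans (h' φ)⟩
  rel_of_le _ _ _ h _ := ⟨fun hv => h hv, know_mem_of_le hS h⟩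
  val_mono _ _ _ h hp := h hp

theorem common_mem_iff (w : World S) (h : Formula.common φ ∈ S) :
    Formula.common φ ∈ w.carrier ↔
      ∀ v, Relation.ReflTransGen (canonicalModel hS).Linked w v → φ ∈ v.carrier := by
  have hclosed := hS.toIsClosedSet
  constructor
  · intro hw v hv
    have hmem : Formula.common φ ∈ v.carrier := by
      induction hv with
      | refl => exact hw
      | tail _ hlinked ih =>
        obtain ⟨a, ha⟩ := hlinked
        exact mem_of_know_mem _ hclosed ((ha _).1 ((mem_of_common_mem _ hclosed ih).2 a))
    exact (v.mem_of_common_mem hclosed hmem).1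
  · exact fun hall => common_mem_of_forall_mem
      (V := {v | Relation.ReflTransGen (canonicalModel hS).Linked w v}) hall h hclosed
      (fun _ hv a _ hu => Relation.ReflTransGen.tail hv ⟨a, hu⟩) .refl

theorem sat_canonicalModel_iff (w : World S) (hφ : φ ∈ S) :
    (canonicalModel hS).Sat φ w ↔ φ ∈ w.carrier := by
  have hclosed := hS.toIsClosedSet
  induction φ generalizing w with
  | bot => exact iff_of_false id w.bot_notMem
  | atom p => exact Iff.rfl
  | and φ ψ ih₁ ih₂ =>
    obtain ⟨hφS, hψS⟩ := hS.and_mem _ _ hφ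
    simp only [Model.Sat, w.and_mem_iff hclosed hφ, ih₁ _ hφS, ih₂ _ hψS]
  | or φ ψ ih₁ ih₂ =>
    obtain ⟨hφS, hψS⟩ := hS.or_mem _ _ hφ
    simp only [Model.Sat, w.or_mem_iff hclosed hφ, ih₁ _ hφS, ih₂ _ hψS]
  | imp φ ψ ih₁ ih₂ =>
    obtain ⟨hφS, hψS⟩ := hS.imp_mem _ _ hφ
    simp only [Model.Sat, w.imp_mem_iff hclosed hφ, ih₁ _ hφS, ih₂ _ hψS, ge_iff_le]
  | know a φ ih =>
    simp only [Model.Sat, w.know_mem_iff hclosed hφ, ih _ (hS.know_mem _ _ hφ)]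
    rfl
  | common φ ih =>
    simp only [Model.Sat, w.common_mem_iff hS hφ, ih _ (hS.common_mem _ hφ).1]

end CanonicalModel

end World

section Completeness

variable {A At : Type*}

open scoped Classical in
theorem unfocused_image_fst {Γ : Finset (AFormula A At)} (hΓ : ∀ φ, (φ, Ann.foc) ∉ Γ) :
    unfocused (Γ.image Prod.fst) = Γ := by
  rw [unfocused, Finset.image_image]
  refine (Finset.image_congr ?_).trans Finset.image_id
  rintro ⟨φ, _ | _⟩ hφ
  · rfl
  · exact absurd hφ (hΓ φ)

variable [Fintype A] {S : Finset (Formula A At)} {σ : SequentOver S}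

open scoped Classical in
theorem mem_winSet_of_derivable_plain
    (h : Derivable S (plain (σ.1.left.image Prod.fst) (σ.1.right.image Prod.fst))) :
    σ ∈ winSet .cICKS5 S := by
  rw [plain, unfocused_image_fst σ.1.left_unfocused] at h
  rw [← holds_iff_mem]
  by_cases hfocus : σ.1.HasFocus
  · obtain ⟨χ, hχ⟩ := hfocus
    have herase : ∀ φ, (φ, Ann.foc) ∉ σ.1.right.erase (χ, .foc) := by
      intro φ hφ
      obtain ⟨hne, hφ⟩ := Finset.mem_erase.1 hφ
      exact hne (by rw [σ.1.focus_unique φ χ hφ hχ])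
    have hσ : σ.1.toPreSequent = ⟨σ.1.left, insert (χ, .foc) (σ.1.right.erase (χ, .foc))⟩ := by
      rw [Finset.insert_erase hχ]
    rw [← Finset.insert_erase hχ, Finset.image_insert, unfocused_insert,
      unfocused_image_fst herase] at h
    rw [hσ]
    exact (Rule.unfocus _ _ χ).holds_winSet trivial ⟨σ, hσ⟩ (by simpa using h)
  · rwa [unfocused_image_fst fun φ hφ => hfocus ⟨φ, hφ⟩] at h

theorem mem_winSet_of_provable [Nonempty A] (hS : IsNegClosedSet (S : Set (Formula A At)))
    (h : Provable .cICKS5 σ.1) : σ ∈ winSet .cICKS5 S := by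
  classical
  by_contra hσ
  obtain ⟨w, hleft, hright⟩ := exists_world
    (Finset.image_subset_iff.2 fun x hx => σ.2 x.1 x.2 (.inl hx))
    (Finset.image_subset_iff.2 fun x hx => σ.2 x.1 x.2 (.inr hx))
    (mt mem_winSet_of_derivable_plain hσ)
  obtain ⟨x, hx, hsat⟩ := (World.canonicalModel hS).exists_sat_of_provable (w := w) h fun x hx =>
    (w.sat_canonicalModel_iff hS (σ.2 x.1 x.2 (.inl hx))).2
      (hleft (Finset.mem_image_of_mem _ hx))
  exact Finset.disjoint_left.1 hright
    ((w.sat_canonicalModel_iff hS (σ.2 x.1 x.2 (.inr hx))).1 hsat) (Finset.mem_image_of_mem _ hx)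

end Completeness

end ICK

theorem mainTheorem10 {A At : Type*} [Fintype A] [Nonempty A] (P : ICK.Calculus)
    (S : Finset (ICK.Formula A At)) (hS : P.IsClosed (S : Set (ICK.Formula A At)))
    (σ : ICK.Sequent A At) (hσ : σ.IsOver S) :
    List.TFAE [
      ICK.Provable P σ,
      ICK.HasProofOver P S σ,
      (ICK.proofSearchGame P S ⟨σ, hσ⟩).HasMemorylessWinningStrategy .prover,
      ICK.HasUniformProofOver P S σ] := by
  tfae_have 3 → 4 := fun h =>
    have ⟨_, hg⟩ := ICK.exists_isWinningChoice_of_hasMemorylessWinningStrategy h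
    hg.hasUniformProofOver
  tfae_have 4 → 2 := fun ⟨t, ht, hS, _⟩ => ⟨t, ht, hS⟩
  tfae_have 2 → 1 := fun ⟨t, ht, _⟩ => ⟨t, ht⟩
  have hwin (h : (⟨σ, hσ⟩ : ICK.SequentOver S) ∈ ICK.winSet P S) :
      (ICK.proofSearchGame P S ⟨σ, hσ⟩).HasMemorylessWinningStrategy .prover :=
    have ⟨_, hg⟩ := ICK.exists_isWinningChoice_of_mem_winSet h
    hg.hasMemorylessWinningStrategy
  tfae_have 1 → 3 := fun h => by
    by_cases hP : P = .cICKS5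
    · subst hP
      exact hwin (ICK.mem_winSet_of_provable hS h)
    · exact hwin (h.hasProofOver hP hS.isClosedSet hσ).mem_winSet
  tfae_finish
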